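/- **Theorem 3.1 (Compactness of $\mathbb{G}^\Omega$).** Let $s,\gamma\in(0,1]$, let $N>2s$, let $\Omega\subset\mathbb{R}^N$ be a bounded $C^2$ domain, let $\delta(x)=\operatorname{dist}(x,\mathbb{R}^N\setminus\Omega)$, and let $D_\Omega=\{(x,x):x\in\Omega\}$. Let $\mathbb{L}$ be a linear operator in $L^2(\Omega)$ with domain $\operatorname{dom}(\mathbb L)\subset L^2(\Omega)$, and assume: * (G1) there is an operator $\mathbb{G}^\Omega$ such that for every $f\in C_c^\infty(\Omega)$ one has $\mathbb{G}^\Omega[f]\in\operatorname{dom}(\mathbb L)$ and $\mathbb{L}[\mathbb{G}^\Omega[f]]=f$ in $L^2(\Omega)$; * (G2) $\mathbb{G}^\Omega[f](x)=\int_\Omega G^\Omega(x,y)f(y)\,dy$ for $f\in C_c^\infty(\Omega)$ and $x\in\Omega$, where $G^\Omega:(\Omega\times\Omega)\setminus D_\Omega\to(0,\infty)$ is Borel measurable and symmetric and there are constants $c,C>0$ with $c\,\Phi(x,y)\le G^\Omega(x,y)\le C\,\Phi(x,y)$ for all $x\ne y$ in $\Omega$, where $$\Phi(x,y)=\frac{1}{|x-y|^{N-2s}}\left(\frac{\delta(x)}{|x-y|}\wedge1\right)^{\gamma}\left(\frac{\delta(y)}{|x-y|}\wedge1\right)^{\gamma};$$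 * (G3*) $G^\Omega$ is jointly continuous on $(\Omega\times\Omega)\setminus D_\Omega$. For $\beta\ge0$ let $\mathcal{M}(\Omega,\delta^{\beta})$ be the space of signed Radon measures $\mu$ on $\Omega$ with $\|\mu\|_{\mathcal{M}(\Omega,\delta^\beta)}:=\int_\Omega\delta^{\beta}\,d|\mu|<\infty$; for $\alpha\in\mathbb R$ and $1\le q<\infty$ let $L^q(\Omega,\delta^\alpha)$ be the $L^q$ space of the measure $\delta^\alpha dx$ on $\Omega$; and set $\mathbb{G}^\Omega[\mu](x)=\int_\Omega G^\Omega(x,y)\,d\mu(y)$. (i) Let $\gamma'\in[0,\gamma)$ and let $\alpha$ satisfy $$(-\gamma'-1)\vee(\gamma'-2s)\vee\left(-\frac{\gamma'N}{N-2s+\gamma'}\right)<\alpha<\frac{\gamma'N}{N-2s}.$$ Then for every $q$ with $1\le q<p^*_{\gamma',\alpha}:=\frac{N+\alpha}{N+\gamma'-2s}$, the map $\mathbb{G}^\Omega:\mathcal{M}(\Omega,\delta^{\gamma'})\to L^q(\Omega,\delta^\alpha)$ is well defined (for each $\mu$ the integral converges absolutely for a.e. $x\in\Omega$, and $\mathbb{G}^\Omega[\mu]\in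 L^q(\Omega,\delta^\alpha)$) and compact, that is, the image of every bounded sequence has a subsequence converging in $L^q(\Omega,\delta^\alpha)$. (ii) Assume in addition that (G4) holds: for every $x_0\in\Omega$ and $z_0\in\partial\Omega$ the limit $$M^\Omega(x_0,z_0)=\lim_{\Omega\times\Omega\ni(x,y)\to(x_0,z_0)}\frac{G^\Omega(x,y)}{\delta(y)^\gamma}$$ exists, and $M^\Omega:\Omega\times\partial\Omega\to[0,\infty)$ is continuous. Then (i) also holds with $\gamma'=\gamma$. -/

import Mathlib

open MeasureTheory Set Filter Topology
open scoped ENNReal ContDiff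

namespace GreenCompactness

/-- Euclidean space `ℝ^N`. -/
abbrev Eu (N : ℕ) : Type := EuclideanSpace ℝ (Fin N)

/-- A bounded domain of class `C²`: a nonempty connected bounded open set which near each of its
boundary points is the strict sublevel set `{φ < 0}` of a `C²` function whose differential does not
vanish at that point. -/
structure IsC2BoundedDomain {N : ℕ} (Ω : Set (Eu N)) : Prop where
  isOpen : IsOpen Ω
  isConnected : IsConnected Ω
  isBounded : Bornology.IsBounded Ω
  boundary : ∀ z ∈ frontier Ω, ∃ r : ℝ, 0 < r ∧ ∃ φ : Eu N → ℝ,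
    ContDiff ℝ 2 φ ∧ fderiv ℝ φ z ≠ 0 ∧ ∀ x ∈ Metric.ball z r, x ∈ Ω ↔ φ x < 0

/-- `δ(x)`, the distance from `x` to `ℝ^N ∖ Ω`. -/
noncomputable def bdist {N : ℕ} (Ω : Set (Eu N)) (x : Eu N) : ℝ := Metric.infDist x Ωᶜ

/-- `(Ω × Ω) ∖ D_Ω`, the product with the diagonal removed. -/
def offDiagonal {N : ℕ} (Ω : Set (Eu N)) : Set (Eu N × Eu N) :=
  {p | p.1 ∈ Ω ∧ p.2 ∈ Ω ∧ p.1 ≠ p.2}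

/-- `C_c^∞(Ω)`. -/
structure IsTestFunction {N : ℕ} (Ω : Set (Eu N)) (f : Eu N → ℝ) : Prop where
  contDiff : ContDiff ℝ ∞ f
  hasCompactSupport : HasCompactSupport f
  tsupport_subset : tsupport f ⊆ Ω

/-- `L²(Ω)`. -/
abbrev L2 {N : ℕ} (Ω : Set (Eu N)) : Type :=
  Lp ℝ 2 ((volume : Measure (Eu N)).restrict Ω)

/-- The operator `𝔾`, on test functions, is a right inverse of the (possibly unbounded) linear
operator `L` of `L²(Ω)`: for every `f ∈ C_c^∞(Ω)`, `𝔾[f]` belongs to the domain of `L` and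
`L[𝔾[f]] = f` in `L²(Ω)`. -/
def IsGreenOperator {N : ℕ} (Ω : Set (Eu N)) (L : L2 Ω →ₗ.[ℝ] L2 Ω)
    (GG : (Eu N → ℝ) → Eu N → ℝ) : Prop :=
  ∀ f : Eu N → ℝ, IsTestFunction Ω f → ∃ u : L.domain,
    ((u : L2 Ω) =ᵐ[volume.restrict Ω] GG f) ∧ (L u =ᵐ[volume.restrict Ω] f)

/-- `|x-y|^{-(N-2s)} (δ(x)/|x-y| ∧ 1)^γ (δ(y)/|x-y| ∧ 1)^γ`. -/
noncomputable def greenProfile {N : ℕ} (Ω : Set (Eu N)) (s γ : ℝ) (x y : Eu N) : ℝ :=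
  1 / ‖x - y‖ ^ ((N : ℝ) - 2 * s)
    * (min (bdist Ω x / ‖x - y‖) 1) ^ γ * (min (bdist Ω y / ‖x - y‖) 1) ^ γ

/-- `G` is a Green function of the operator `𝔾`: a Borel measurable, positive, symmetric kernel on
`(Ω × Ω) ∖ D_Ω` with the two-sided estimate of exponents `s, γ`, which represents `𝔾`. The values of
`G` elsewhere are irrelevant. -/
structure IsGreenFunction {N : ℕ} (Ω : Set (Eu N)) (s γ : ℝ)
    (GG : (Eu N → ℝ) → Eu N → ℝ) (G : Eu N → Eu N → ℝ) : Prop where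
  represents : ∀ f : Eu N → ℝ, IsTestFunction Ω f → ∀ x ∈ Ω, GG f x = ∫ y in Ω, G x y * f y
  measurable : Measurable ((offDiagonal Ω).domRestrict (Function.uncurry G))
  pos : ∀ x ∈ Ω, ∀ y ∈ Ω, x ≠ y → 0 < G x y
  symm : ∀ x ∈ Ω, ∀ y ∈ Ω, x ≠ y → G x y = G y x
  estimate : ∃ c C : ℝ, 0 < c ∧ 0 < C ∧ ∀ x ∈ Ω, ∀ y ∈ Ω, x ≠ y →
    c * greenProfile Ω s γ x y ≤ G x y ∧ G x y ≤ C * greenProfile Ω s γ x y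

/-- For all `x₀ ∈ Ω`, `z₀ ∈ ∂Ω` the limit `M(x₀, z₀)` of `G(x,y) / δ(y)^γ` as
`Ω × Ω ∋ (x,y) → (x₀,z₀)` exists, and `M : Ω × ∂Ω → [0,∞)` is continuous. -/
def HasMartinLimit {N : ℕ} (Ω : Set (Eu N)) (γ : ℝ) (G : Eu N → Eu N → ℝ) : Prop :=
  ∃ M : Eu N → Eu N → ℝ,
    (∀ x₀ ∈ Ω, ∀ z₀ ∈ frontier Ω, 0 ≤ M x₀ z₀ ∧
      Tendsto (fun p : Eu N × Eu N => G p.1 p.2 / bdist Ω p.2 ^ γ)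
        (𝓝[Ω ×ˢ Ω] (x₀, z₀)) (𝓝 (M x₀ z₀))) ∧
    ContinuousOn (Function.uncurry M) (Ω ×ˢ frontier Ω)

/-- A signed Radon measure on the open set `Ω`, given by its Jordan decomposition: two mutually
singular Borel measures carried by `Ω` and finite on the compact subsets of `Ω`. Both may have
infinite total mass. -/
structure SignedRadonMeasure {N : ℕ} (Ω : Set (Eu N)) where
  posPart : Measure (Eu N)
  negPart : Measure (Eu N)
  posPart_compl : posPart Ωᶜ = 0
  negPart_compl : negPart Ωᶜ = 0
  posPart_compact : ∀ K : Set (Eu N), IsCompact K → K ⊆ Ω → posPart K < ⊤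
  negPart_compact : ∀ K : Set (Eu N), IsCompact K → K ⊆ Ω → negPart K < ⊤
  mutuallySingular : posPart.MutuallySingular negPart

namespace SignedRadonMeasure

variable {N : ℕ} {Ω : Set (Eu N)}

/-- The total variation measure `|μ|`. -/
noncomputable def variation (μ : SignedRadonMeasure Ω) : Measure (Eu N) :=
  μ.posPart + μ.negPart

/-- The integral `∫ f dμ`, meaningful when `f` is `|μ|`-integrable. -/
noncomputable def integral (μ : SignedRadonMeasure Ω) (f : Eu N → ℝ) : ℝ :=
  (∫ y, f y ∂μ.posPart) - ∫ y, f y ∂μ.negPart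

/-- The norm `‖μ‖ = ∫_Ω δ^β d|μ|` of `𝓜(Ω, δ^β)`, with values in `[0,∞]`. The space `𝓜(Ω, δ^β)`
consists of the `μ` for which it is finite. -/
noncomputable def weightedNorm (β : ℝ) (μ : SignedRadonMeasure Ω) : ℝ≥0∞ :=
  ∫⁻ y in Ω, ENNReal.ofReal (bdist Ω y ^ β) ∂μ.variation

/-- `𝔾[μ](x) = ∫_Ω G(x,y) dμ(y)`. -/
noncomputable def green (G : Eu N → Eu N → ℝ) (μ : SignedRadonMeasure Ω) (x : Eu N) : ℝ :=
  μ.integral (G x)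

end SignedRadonMeasure

/-- The measure `δ^α dx` on `Ω`; the space `L^q(Ω, δ^α)` is the `L^q` space of this measure. -/
noncomputable def weightedVolume {N : ℕ} (Ω : Set (Eu N)) (α : ℝ) : Measure (Eu N) :=
  (volume.restrict Ω).withDensity fun x => ENNReal.ofReal (bdist Ω x ^ α)

/-- `μ ↦ 𝔾[μ]` is a compact operator from `𝓜(Ω, δ^β)` to `L^q(Ω, δ^α)`: for every `μ ∈ 𝓜(Ω, δ^β)`
the integral defining `𝔾[μ](x)` converges absolutely for a.e. `x ∈ Ω` and `𝔾[μ] ∈ L^q(Ω, δ^α)`, and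
the image of every bounded sequence has a subsequence that converges in `L^q(Ω, δ^α)`. -/
structure IsCompactGreenMap {N : ℕ} (Ω : Set (Eu N)) (G : Eu N → Eu N → ℝ) (β α q : ℝ) :
    Prop where
  integrable : ∀ μ : SignedRadonMeasure Ω, μ.weightedNorm β < ⊤ →
    ∀ᵐ x ∂(volume.restrict Ω), Integrable (G x) μ.variation
  memLp : ∀ μ : SignedRadonMeasure Ω, μ.weightedNorm β < ⊤ →
    MemLp (μ.green G) (ENNReal.ofReal q) (weightedVolume Ω α)
  compact : ∀ (μ : ℕ → SignedRadonMeasure Ω) (R : ℝ≥0∞), R < ⊤ →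
    (∀ n, (μ n).weightedNorm β ≤ R) →
    ∃ k : ℕ → ℕ, StrictMono k ∧ ∃ u : Eu N → ℝ,
      MemLp u (ENNReal.ofReal q) (weightedVolume Ω α) ∧
      Tendsto (fun n => eLpNorm (fun x => (μ (k n)).green G x - u x)
        (ENNReal.ofReal q) (weightedVolume Ω α)) atTop (𝓝 0)

/-- `max (-β-1) (β-2s) (-βN/(N-2s+β)) < α < βN/(N-2s)`. -/
def Admissible (N : ℕ) (s β α : ℝ) : Prop :=
  max (max (-β - 1) (β - 2 * s)) (-(β * N / (N - 2 * s + β))) < α ∧ α < β * N / (N - 2 * s)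

/-- The critical exponent `p*_{β,α} = (N+α)/(N+β-2s)`. -/
noncomputable def critExp (N : ℕ) (s β α : ℝ) : ℝ := (N + α) / (N + β - 2 * s)

end GreenCompactness

namespace GreenCompactness

open Metric

open scoped NNReal

/-!
The kernel `G(x, y) δ(y)^{-β}` is `O(|x - y|^{-(N - 2s + β - θ)} δ(x)^{-θ})` for each `θ ∈ [-γ, β]`.
With a suitable `θ`, its `q`-th power weighted by `δ(x)^α` is dominated by `δ(x)^{-a} |x - y|^{-b}`,
where `0 ≤ a < 1` and `a + b < N`. Near the boundary of a `C²` domain the collars `{δ ≤ t}` are so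
thin that balls of radius `r` have `δ^{-a} dx`-measure `O(r^{N - a})`, so these majorants are
uniformly integrable. Hence the slices `G(·, y) δ(y)^{-β}` converge in `L^q(Ω, δ^α)` as `y` tends to
any point of the compact set `closure Ω`; at boundary points the limit is `0` if `β < γ`, and it is
the Martin kernel if `β = γ`. Thus the slices are uniformly approximable by finitely many elements
of `L^q`, and `𝔾[μ]` is the integral of the slices against the finite signed measure `δ^β μ`, so
approximating the slices by simple functions shows that bounded sets have totally bounded images.
-/

/-! ### Thin collars -/

section Translates

variable {E : Type*} [NormedAddCommGroup E] [MeasurableSpace E] [BorelSpace E]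

/-- About `ρ / ‖w‖` disjoint translates of `A` fit into the ball of radius `2 * ρ`. -/
theorem measure_le_of_translates_notMem (μ : Measure E) [μ.IsAddRightInvariant] {A : Set E}
    (hA : MeasurableSet A) {w y : E} {ρ : ℝ} (hρ : 0 < ρ) (hw : w ≠ 0) (hAρ : A ⊆ closedBall y ρ)
    (hAw : ∀ x ∈ A, ∀ j : ℕ, j ≠ 0 → x + j • w ∉ A) :
    μ A ≤ ENNReal.ofReal (‖w‖ / ρ) * μ (closedBall y (2 * ρ)) := by
  have hw' : 0 < ‖w‖ := norm_pos_iff.mpr hw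
  set m : ℕ := ⌊ρ / ‖w‖⌋₊
  let T : ℕ → Set E := fun k ↦ (· + -(k • w)) ⁻¹' A
  have hdisj : Pairwise (Function.onFun Disjoint T) := by
    refine (pairwise_disjoint_on T).mpr fun i j hij ↦ disjoint_left.mpr fun x hi hj ↦ ?_
    refine hAw _ hj (j - i) (Nat.sub_ne_zero_of_lt hij) ?_
    have : x + -(j • w) + (j - i) • w = x + -(i • w) := by
      rw [sub_nsmul w hij.le]; abel
    exact this ▸ hi
  have hsub : ⋃ k ∈ Finset.range (m + 1), T k ⊆ closedBall y (2 * ρ) := by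
    refine iUnion₂_subset fun k hk x hx ↦ ?_
    have hkm : (k : ℝ) ≤ ρ / ‖w‖ :=
      (Nat.le_floor_iff (by positivity)).mp (Nat.lt_succ_iff.mp (Finset.mem_range.mp hk))
    have hkw : ‖k • w‖ ≤ ρ := (norm_nsmul_le).trans ((le_div_iff₀ hw').mp hkm)
    calc dist x y ≤ dist x (x + -(k • w)) + dist (x + -(k • w)) y := dist_triangle _ _ _
      _ ≤ ρ + ρ := add_le_add (by simpa using hkw) (hAρ hx)
      _ = 2 * ρ := by ring
  have hone : 1 ≤ ENNReal.ofReal (‖w‖ / ρ) * (m + 1 : ℕ) := by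
    rw [← ENNReal.ofReal_natCast, ← ENNReal.ofReal_mul (by positivity), ENNReal.one_le_ofReal]
    calc 1 = ‖w‖ / ρ * (ρ / ‖w‖) := by field_simp
      _ ≤ ‖w‖ / ρ * (m + 1 : ℕ) := by gcongr; exact_mod_cast (Nat.lt_floor_add_one _).le
  calc μ A ≤ ENNReal.ofReal (‖w‖ / ρ) * (m + 1 : ℕ) * μ A := le_mul_of_one_le_left' hone
    _ = ENNReal.ofReal (‖w‖ / ρ) * μ (⋃ k ∈ Finset.range (m + 1), T k) := by
      rw [measure_biUnion_finset (fun i _ j _ hij ↦ hdisj hij) fun k _ ↦ hA.preimage (by fun_prop)]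
      simp [T, measure_preimage_add_right, mul_assoc]
    _ ≤ ENNReal.ofReal (‖w‖ / ρ) * μ (closedBall y (2 * ρ)) := by gcongr

end Translates

section Sublevel

theorem exists_mul_le_sub_of_hasStrictFDerivAt {E : Type*} [NormedAddCommGroup E] [NormedSpace ℝ E]
    {φ : E → ℝ} {φ' : E →L[ℝ] ℝ} {z v : E} (hφ : HasStrictFDerivAt φ φ' z) (hv : 0 < φ' v) :
    ∃ c > 0, ∃ U ∈ 𝓝 z, ∀ x ∈ U, ∀ h : ℝ, 0 ≤ h → x + h • v ∈ U →
      c * h ≤ φ (x + h • v) - φ x := by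
  have hv' : 0 < ‖v‖ := norm_pos_iff.mpr (by rintro rfl; simp at hv)
  have hsmall := hφ.isLittleO.def (c := φ' v / 2 / ‖v‖) (by positivity)
  rw [nhds_prod_eq] at hsmall
  obtain ⟨U, hU, hUφ⟩ := mem_prod_self_iff.mp hsmall
  refine ⟨φ' v / 2, by positivity, U, hU, fun x hx h hh hxh ↦ ?_⟩
  have hrem : |φ (x + h • v) - φ x - h * φ' v| ≤ φ' v / 2 / ‖v‖ * (h * ‖v‖) := by
    simpa [norm_smul, abs_of_nonneg hh] using hUφ (mk_mem_prod hxh hx)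
  have hscale : φ' v / 2 / ‖v‖ * (h * ‖v‖) = φ' v / 2 * h := by field_simp
  linarith [neg_le_of_abs_le hrem]

theorem eventually_neg_mul_infDist_le {X : Type*} [PseudoMetricSpace X] [ProperSpace X]
    {S U : Set X} {z : X} {φ : X → ℝ} {L : ℝ≥0} (hS : IsClosed S) (hz : z ∈ S) (hU : U ∈ 𝓝 z)
    (hL : LipschitzOnWith L φ U) (hφ : ∀ᶠ x in 𝓝 z, x ∈ S → 0 ≤ φ x) :
    ∀ᶠ x in 𝓝 z, -(L * infDist x S) ≤ φ x := by
  obtain ⟨r, hr, hball⟩ := Metric.eventually_nhds_iff.mp (hφ.and hU)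
  filter_upwards [ball_mem_nhds z (half_pos hr)] with x hx
  rw [mem_ball] at hx
  obtain ⟨p, hpS, hp⟩ := hS.exists_infDist_eq_dist ⟨z, hz⟩ x
  have hpz : dist p z < r := by
    have := infDist_le_dist_of_mem (x := x) hz
    linarith [dist_triangle p x z, dist_comm p x]
  have hlip := hL.dist_le_mul p (hball hpz).2 x (hball (by linarith)).2
  rw [Real.dist_eq, dist_comm, ← hp] at hlip
  linarith [le_of_abs_le hlip, (hball hpz).1 hpS]

end Sublevel

variable {N : ℕ} {Ω : Set (Eu N)}

theorem continuous_bdist (Ω : Set (Eu N)) : Continuous (bdist Ω) :=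
  continuous_infDist_pt _

theorem bdist_nonneg (Ω : Set (Eu N)) (x : Eu N) : 0 ≤ bdist Ω x :=
  infDist_nonneg

theorem bdist_le_add (Ω : Set (Eu N)) (x y : Eu N) : bdist Ω x ≤ bdist Ω y + ‖x - y‖ := by
  rw [← dist_eq_norm]
  exact infDist_le_infDist_add_dist

theorem bdist_pos [NeZero N] (ho : IsOpen Ω) (hb : Bornology.IsBounded Ω) {x : Eu N}
    (hx : x ∈ Ω) : 0 < bdist Ω x := by
  have hne : Ωᶜ.Nonempty :=
    nonempty_compl.mpr fun h ↦ NormedSpace.unbounded_univ ℝ (Eu N) (h ▸ hb)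
  exact (ho.isClosed_compl.notMem_iff_infDist_pos hne).mp (notMem_compl_iff.mpr hx)

/-- The collar of width `t` of `Ω`: the points of `Ω` at distance at most `t` from the
complement. -/
def collar (Ω : Set (Eu N)) (t : ℝ) : Set (Eu N) := {x ∈ Ω | bdist Ω x ≤ t}

theorem measurableSet_collar (ho : IsOpen Ω) (t : ℝ) : MeasurableSet (collar Ω t) :=
  ho.measurableSet.inter (isClosed_le (continuous_bdist Ω) continuous_const).measurableSet

theorem exists_volume_collar_le_of_mem [NeZero N] (ho : IsOpen Ω) (hb : Bornology.IsBounded Ω)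
    {z : Eu N} (hz : z ∈ Ω) :
    ∃ U ∈ 𝓝 z, ∃ C : ℝ≥0, ∀ (y : Eu N) (ρ t : ℝ), 0 < t → t ≤ ρ →
      volume (collar Ω t ∩ U ∩ closedBall y ρ) ≤ C * ENNReal.ofReal (t / ρ * ρ ^ N) := by
  have hd : 0 < bdist Ω z / 2 := half_pos (bdist_pos ho hb hz)
  refine ⟨{x | bdist Ω z / 2 < bdist Ω x},
    (continuous_bdist Ω).continuousAt.eventually (lt_mem_nhds (by linarith)),
    ((volume Ω).toNNReal / Real.toNNReal ((bdist Ω z / 2) ^ N)), fun y ρ t ht htρ ↦ ?_⟩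
  rcases le_or_gt t (bdist Ω z / 2) with h | h
  · have hempty : collar Ω t ∩ {x | bdist Ω z / 2 < bdist Ω x} = ∅ :=
      disjoint_iff_inter_eq_empty.mp <| disjoint_left.mpr fun x hx hx' ↦
        (hx.2.trans h).not_gt hx'
    simp [hempty]
  · have hpow : (bdist Ω z / 2) ^ N ≤ t / ρ * ρ ^ N := by
      obtain ⟨n, rfl⟩ := Nat.exists_eq_succ_of_ne_zero (NeZero.ne N)
      have hρ : 0 < ρ := ht.trans_le htρ
      calc (bdist Ω z / 2) ^ (n + 1) ≤ t * t ^ n := by rw [← pow_succ']; gcongr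
        _ ≤ t * ρ ^ n := by gcongr
        _ = t / ρ * ρ ^ (n + 1) := by rw [pow_succ']; field_simp
    have hfin : ((volume Ω).toNNReal : ℝ≥0∞) = volume Ω :=
      ENNReal.coe_toNNReal hb.measure_lt_top.ne
    have hpos : 0 < (bdist Ω z / 2) ^ N := by positivity
    calc volume (collar Ω t ∩ {x | bdist Ω z / 2 < bdist Ω x} ∩ closedBall y ρ)
        ≤ volume Ω := measure_mono fun x hx ↦ hx.1.1.1
      _ = volume Ω / ENNReal.ofReal ((bdist Ω z / 2) ^ N)
          * ENNReal.ofReal ((bdist Ω z / 2) ^ N) :=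
        (ENNReal.div_mul_cancel (by simpa using hpos) ENNReal.ofReal_ne_top).symm
      _ ≤ _ := by
        rw [ENNReal.coe_div (by simpa using hpos), hfin, ENNReal.ofReal]
        gcongr
        exact ENNReal.coe_le_coe.mpr (Real.toNNReal_le_toNNReal hpow)

/-- Translating a thin collar in a direction along which `φ` increases moves it off `Ω`. -/
theorem exists_volume_collar_le_of_sublevel (ho : IsOpen Ω) {φ : Eu N → ℝ} {φ' : Eu N →L[ℝ] ℝ}
    {z : Eu N} (hz : z ∉ Ω) (hφ : HasStrictFDerivAt φ φ' z) (hφ' : φ' ≠ 0)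
    (hΩφ : ∀ᶠ x in 𝓝 z, x ∈ Ω ↔ φ x < 0) :
    ∃ U ∈ 𝓝 z, ∃ C : ℝ≥0, ∀ (y : Eu N) (ρ t : ℝ), 0 < t → t ≤ ρ →
      volume (collar Ω t ∩ U ∩ closedBall y ρ) ≤ C * ENNReal.ofReal (t / ρ * ρ ^ N) := by
  obtain ⟨v, hv⟩ : ∃ v, 0 < φ' v := by
    obtain ⟨v, hv⟩ := DFunLike.ne_iff.mp hφ'
    rcases lt_or_gt_of_ne hv with h | h
    · exact ⟨-v, by simpa using h⟩
    · exact ⟨v, h⟩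
  obtain ⟨c, hc, W, hW, hgrow⟩ := exists_mul_le_sub_of_hasStrictFDerivAt hφ hv
  obtain ⟨V, hV, hlip⟩ := hφ.exists_lipschitzOnWith_of_nnnorm_lt (‖φ'‖₊ + 1) (by simp)
  set L : ℝ≥0 := ‖φ'‖₊ + 1
  have hL : 0 < L := by positivity
  have hlow : ∀ᶠ x in 𝓝 z, -(L * bdist Ω x) ≤ φ x :=
    eventually_neg_mul_infDist_le ho.isClosed_compl hz hV hlip <|
      hΩφ.mono fun x hx hxΩ ↦ not_lt.mp fun h ↦ hxΩ (hx.mpr h)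
  obtain ⟨r, hr, hball⟩ := Metric.mem_nhds_iff.mp (inter_mem hW (hΩφ.and hlow))
  refine ⟨ball z r, ball_mem_nhds z hr, Real.toNNReal (L / c * ‖v‖ * 2 ^ N) *
    (volume (ball (0 : Eu N) 1)).toNNReal, fun y ρ t ht htρ ↦ ?_⟩
  have hρ : 0 < ρ := ht.trans_le htρ
  have hv0 : v ≠ 0 := by rintro rfl; simp at hv
  have hstep : 0 < L * t / c := by positivity
  refine (measure_le_of_translates_notMem volume (w := (L * t / c) • v)
    (((measurableSet_collar ho t).inter measurableSet_ball).inter measurableSet_closedBall) hρ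
    (smul_ne_zero hstep.ne' hv0) inter_subset_right ?_).trans_eq ?_
  · rintro x ⟨⟨⟨_, hxt⟩, hxr⟩, _⟩ j hj ⟨⟨⟨hx'Ω, _⟩, hx'r⟩, _⟩
    rw [← Nat.cast_smul_eq_nsmul ℝ, smul_smul] at hx'Ω hx'r
    have hneg := (hball hx'r).2.1.mp hx'Ω
    have hinc := hgrow x (hball hxr).1 _ (by positivity) (hball hx'r).1
    have hxφ : -(L * t) ≤ φ x :=
      (neg_le_neg (mul_le_mul_of_nonneg_left hxt L.2)).trans (hball hxr).2.2
    have hj' : (1 : ℝ) ≤ j := Nat.one_le_cast.mpr (Nat.one_le_iff_ne_zero.mpr hj)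
    have hLt : L * t ≤ c * (j * (L * t / c)) :=
      calc L * t ≤ j * (L * t) := le_mul_of_one_le_left (by positivity) hj'
        _ = c * (j * (L * t / c)) := by field_simp
    linarith
  · rw [Measure.addHaar_closedBall _ _ (by positivity), ENNReal.coe_mul,
      ENNReal.coe_toNNReal measure_ball_lt_top.ne, ← ENNReal.ofReal, finrank_euclideanSpace_fin,
      mul_right_comm, ← ENNReal.ofReal_mul (by positivity), ← mul_assoc,
      ← ENNReal.ofReal_mul (by positivity), norm_smul, Real.norm_of_nonneg hstep.le]
    congr 2
    rw [mul_pow]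
    field_simp

/-- A bounded open set whose boundary collars have, in every ball, at most the measure of a plate
of the same width. The smoothness of `∂Ω` enters through this property only. -/
structure IsThinCollarDomain (Ω : Set (Eu N)) : Prop where
  isOpen : IsOpen Ω
  isBounded : Bornology.IsBounded Ω
  volume_collar_le : ∃ C : ℝ≥0, ∀ (y : Eu N) (ρ t : ℝ), 0 < t → t ≤ ρ →
    volume (collar Ω t ∩ closedBall y ρ) ≤ C * ENNReal.ofReal (t / ρ * ρ ^ N)

theorem IsC2BoundedDomain.isThinCollarDomain [NeZero N] (hΩ : IsC2BoundedDomain Ω) :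
    IsThinCollarDomain Ω where
  isOpen := hΩ.isOpen
  isBounded := hΩ.isBounded
  volume_collar_le := by
    suffices ∃ C : ℝ≥0, ∀ (y : Eu N) (ρ t : ℝ), 0 < t → t ≤ ρ →
        volume (collar Ω t ∩ closure Ω ∩ closedBall y ρ) ≤
          C * ENNReal.ofReal (t / ρ * ρ ^ N) by
      have hsub (t : ℝ) : collar Ω t ⊆ closure Ω := fun x hx ↦ subset_closure hx.1
      simpa only [inter_eq_self_of_subset_left (hsub _)] using this
    refine hΩ.isBounded.isCompact_closure.induction_on (p := fun S ↦ ∃ C : ℝ≥0,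
      ∀ (y : Eu N) (ρ t : ℝ), 0 < t → t ≤ ρ →
        volume (collar Ω t ∩ S ∩ closedBall y ρ) ≤ C * ENNReal.ofReal (t / ρ * ρ ^ N))
      ⟨0, by simp⟩ ?_ ?_ fun z hz ↦ ?_
    · rintro S T hST ⟨C, hC⟩
      exact ⟨C, fun y ρ t ht htρ ↦ (measure_mono (by gcongr)).trans (hC y ρ t ht htρ)⟩
    · rintro S T ⟨C, hC⟩ ⟨C', hC'⟩
      refine ⟨C + C', fun y ρ t ht htρ ↦ ?_⟩
      rw [ENNReal.coe_add, add_mul, inter_union_distrib_left, union_inter_distrib_right]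
      exact (measure_union_le _ _).trans (add_le_add (hC y ρ t ht htρ) (hC' y ρ t ht htρ))
    · obtain ⟨U, hU, hvol⟩ : ∃ U ∈ 𝓝 z, ∃ C : ℝ≥0, ∀ (y : Eu N) (ρ t : ℝ), 0 < t → t ≤ ρ →
          volume (collar Ω t ∩ U ∩ closedBall y ρ) ≤ C * ENNReal.ofReal (t / ρ * ρ ^ N) := by
        by_cases hzΩ : z ∈ Ω
        · exact exists_volume_collar_le_of_mem hΩ.isOpen hΩ.isBounded hzΩ
        · obtain ⟨r, hr, φ, hφ, hφ', hΩφ⟩ :=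
            hΩ.boundary z ⟨hz, by rwa [hΩ.isOpen.interior_eq]⟩
          exact exists_volume_collar_le_of_sublevel hΩ.isOpen hzΩ
            (hφ.contDiffAt.hasStrictFDerivAt (by simp)) hφ'
            (eventually_of_mem (ball_mem_nhds z hr) hΩφ)
      exact ⟨U, mem_nhdsWithin_of_mem_nhds hU, hvol⟩

/-! ### Upper regular measures -/

section UpperRegular

theorem dyadic_rpow_mul_rpow {ρ : ℝ} (hρ : 0 < ρ) (a d : ℝ) (k : ℕ) :
    ((1 / 2) ^ (k + 1) * ρ) ^ (-a) * ((1 / 2) ^ k * ρ) ^ d =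
      2 ^ a * ρ ^ (d - a) * (2 ^ (a - d)) ^ k := by
  have hpow : (2 : ℝ) ^ ((k : ℝ) * (a - d)) = (2 ^ (a - d)) ^ k := by
    rw [mul_comm, Real.rpow_mul zero_le_two, Real.rpow_natCast]
  have hhalf (n : ℕ) : (1 / 2 : ℝ) ^ n = 2 ^ (-(n : ℝ)) := by
    rw [Real.rpow_neg zero_le_two, Real.rpow_natCast, ← inv_pow, ← one_div]
  rw [← hpow, hhalf, hhalf, Real.mul_rpow (by positivity) hρ.le,
    Real.mul_rpow (by positivity) hρ.le, ← Real.rpow_mul zero_le_two, ← Real.rpow_mul zero_le_two,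
    sub_eq_add_neg d a, Real.rpow_add hρ]
  calc _ = 2 ^ (-((k + 1 : ℕ) : ℝ) * -a) * 2 ^ (-(k : ℝ) * d) * (ρ ^ d * ρ ^ (-a)) := by ring
    _ = 2 ^ a * 2 ^ ((k : ℝ) * (a - d)) * (ρ ^ d * ρ ^ (-a)) := by
      rw [← Real.rpow_add two_pos, ← Real.rpow_add two_pos]; push_cast; ring_nf
    _ = _ := by ring

/-- Sum over the dyadic shells `2 ^ (-k - 1) * ρ < f ≤ 2 ^ (-k) * ρ`. -/
theorem lintegral_rpow_neg_le_of_measure_le {X : Type*} [MeasurableSpace X] {μ : Measure X}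
    {f : X → ℝ} (hf : Measurable f) {A : ℝ≥0∞} {a d ρ : ℝ} (ha : 0 ≤ a) (had : a < d)
    (hρ : 0 < ρ) (hfρ : ∀ᵐ x ∂μ, f x ∈ Ioc 0 ρ)
    (hA : ∀ t ∈ Ioc 0 ρ, μ {x | f x ≤ t} ≤ A * ENNReal.ofReal (t ^ d)) :
    ∫⁻ x, ENNReal.ofReal (f x ^ (-a)) ∂μ ≤
      A * ENNReal.ofReal (2 ^ a / (1 - 2 ^ (a - d)) * ρ ^ (d - a)) := by
  set θ : ℝ := 2 ^ (a - d)
  have hθ : θ < 1 := Real.rpow_lt_one_of_one_lt_of_neg one_lt_two (by linarith)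
  let t : ℕ → ℝ := fun k ↦ (1 / 2) ^ k * ρ
  have ht : ∀ k, 0 < t k := fun k ↦ by positivity
  have hS : ∀ k, MeasurableSet {x | f x ≤ t k} := fun k ↦ hf measurableSet_Iic
  have hshell : ∀ᵐ x ∂μ, ENNReal.ofReal (f x ^ (-a)) ≤
      ∑' k, {x | f x ≤ t k}.indicator (fun _ ↦ ENNReal.ofReal (t (k + 1) ^ (-a))) x := by
    filter_upwards [hfρ] with x hx
    obtain ⟨k, hk, hk'⟩ := exists_nat_pow_near_of_lt_one (x := f x / ρ) (y := (1 / 2 : ℝ))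
      (div_pos hx.1 hρ) ((div_le_one hρ).mpr hx.2) (by norm_num) (by norm_num)
    have hmem : x ∈ {x | f x ≤ t k} := (div_le_iff₀ hρ).mp hk'
    refine le_trans ?_ (ENNReal.le_tsum k)
    rw [indicator_of_mem hmem]
    exact ENNReal.ofReal_le_ofReal <|
      Real.rpow_le_rpow_of_nonpos (ht _) ((lt_div_iff₀ hρ).mp hk).le (neg_nonpos.mpr ha)
  calc ∫⁻ x, ENNReal.ofReal (f x ^ (-a)) ∂μ
      ≤ ∑' k, ENNReal.ofReal (t (k + 1) ^ (-a)) * μ {x | f x ≤ t k} := by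
        refine (lintegral_mono_ae hshell).trans_eq ?_
        rw [lintegral_tsum fun k ↦ (measurable_const.indicator (hS k)).aemeasurable]
        simp only [lintegral_indicator_const (hS _)]
    _ ≤ ∑' k, A * ENNReal.ofReal (2 ^ a * ρ ^ (d - a)) * ENNReal.ofReal θ ^ k := by
        refine ENNReal.tsum_le_tsum fun k ↦ ?_
        have htρ : t k ≤ ρ :=
          mul_le_of_le_one_left hρ.le (pow_le_one₀ (by norm_num) (by norm_num))
        grw [hA (t k) ⟨ht k, htρ⟩]
        rw [mul_left_comm, ← ENNReal.ofReal_mul (by positivity), dyadic_rpow_mul_rpow hρ,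
          mul_assoc A, ← ENNReal.ofReal_pow (by positivity), ← ENNReal.ofReal_mul (by positivity)]
    _ = A * ENNReal.ofReal (2 ^ a / (1 - θ) * ρ ^ (d - a)) := by
        rw [ENNReal.tsum_mul_left, ENNReal.tsum_geometric, mul_assoc, ← ENNReal.ofReal_one,
          ← ENNReal.ofReal_sub _ (by positivity), ← ENNReal.ofReal_inv_of_pos (sub_pos.mpr hθ),
          ← ENNReal.ofReal_mul (by positivity)]
        ring_nf

variable {X : Type*} [MetricSpace X] [MeasurableSpace X] {m : Measure X} {b d : ℝ}

/-- Upper `d`-regularity: balls of radius `ρ` have measure `O(ρ ^ d)`, uniformly in the centre and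
the radius. -/
def IsUpperRegular (m : Measure X) (d : ℝ) : Prop :=
  ∃ C : ℝ≥0, ∀ (y : X) (ρ : ℝ), 0 < ρ → m (closedBall y ρ) ≤ C * ENNReal.ofReal (ρ ^ d)

theorem tendsto_const_mul_ofReal_rpow_nhdsGT_zero (hd : 0 < d) (C : ℝ≥0) :
    Tendsto (fun ρ : ℝ ↦ C * ENNReal.ofReal (ρ ^ d)) (𝓝[>] 0) (𝓝 0) := by
  have hpow : Tendsto (fun ρ : ℝ ↦ ρ ^ d) (𝓝[>] 0) (𝓝 0) := by
    simpa [Real.zero_rpow hd.ne'] using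
      (Real.continuousAt_rpow_const 0 d (Or.inr hd.le)).tendsto.mono_left nhdsWithin_le_nhds
  simpa using ENNReal.Tendsto.const_mul (ENNReal.tendsto_ofReal hpow) (Or.inr ENNReal.coe_ne_top)

theorem IsUpperRegular.nullSingletonClass (hm : IsUpperRegular m d) (hd : 0 < d) :
    NullSingletonClass m where
  measure_singleton y := by
    obtain ⟨C, hC⟩ := hm
    refine le_bot_iff.mp <| ge_of_tendsto (tendsto_const_mul_ofReal_rpow_nhdsGT_zero hd C) ?_
    filter_upwards [self_mem_nhdsWithin] with ρ hρ
    exact (measure_mono (by simp [le_of_lt (mem_Ioi.mp hρ)])).trans (hC y ρ hρ)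

variable [OpensMeasurableSpace X]

theorem IsUpperRegular.exists_setLIntegral_rpow_neg_dist_le (hm : IsUpperRegular m d) (hb : 0 ≤ b)
    (hbd : b < d) :
    ∃ C : ℝ≥0, ∀ (y : X) (ρ : ℝ), 0 < ρ →
      ∫⁻ x in closedBall y ρ, ENNReal.ofReal (dist x y ^ (-b)) ∂m ≤
        C * ENNReal.ofReal (ρ ^ (d - b)) := by
  have := hm.nullSingletonClass (hb.trans_lt hbd)
  obtain ⟨C, hC⟩ := hm
  refine ⟨C * (2 ^ b / (1 - 2 ^ (b - d)) : ℝ).toNNReal, fun y ρ hρ ↦ ?_⟩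
  have hθ : (2 : ℝ) ^ (b - d) < 1 := Real.rpow_lt_one_of_one_lt_of_neg one_lt_two (by linarith)
  have hmem : ∀ᵐ x ∂m.restrict (closedBall y ρ), dist x y ∈ Ioc 0 ρ := by
    filter_upwards [ae_restrict_mem measurableSet_closedBall,
      ae_restrict_of_ae (Measure.ae_ne m y)] with x hx hxy using ⟨dist_pos.mpr hxy, hx⟩
  refine (lintegral_rpow_neg_le_of_measure_le (A := C)
    (continuous_id.dist continuous_const).measurable hb hbd hρ hmem fun t ht ↦
      (Measure.restrict_apply_le _ _).trans (hC y t ht.1)).trans_eq ?_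
  rw [ENNReal.ofReal_mul (div_nonneg (by positivity) (sub_pos.mpr hθ).le), ENNReal.coe_mul,
    ENNReal.ofNNReal_toNNReal, mul_assoc]

theorem IsUpperRegular.exists_forall_setLIntegral_rpow_neg_dist_le (hm : IsUpperRegular m d)
    (hb : 0 ≤ b) (hbd : b < d) {ε : ℝ≥0∞} (hε : 0 < ε) :
    ∃ ρ > 0, ∀ y, ∫⁻ x in closedBall y ρ, ENNReal.ofReal (dist x y ^ (-b)) ∂m ≤ ε := by
  obtain ⟨C, hC⟩ := hm.exists_setLIntegral_rpow_neg_dist_le hb hbd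
  obtain ⟨ρ, hρε, hρ⟩ := ((tendsto_const_mul_ofReal_rpow_nhdsGT_zero (sub_pos.mpr hbd) C).eventually
    (eventually_le_nhds hε)).and self_mem_nhdsWithin |>.exists
  exact ⟨ρ, hρ, fun y ↦ (hC y ρ hρ).trans hρε⟩

theorem IsUpperRegular.lintegral_rpow_neg_dist_lt_top [IsFiniteMeasure m]
    (hm : IsUpperRegular m d) (hb : 0 ≤ b) (hbd : b < d) (y : X) :
    ∫⁻ x, ENNReal.ofReal (dist x y ^ (-b)) ∂m < ⊤ := by
  obtain ⟨ρ, hρ, hnear⟩ := hm.exists_forall_setLIntegral_rpow_neg_dist_le hb hbd one_pos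
  have hfar : ∫⁻ x in (closedBall y ρ)ᶜ, ENNReal.ofReal (dist x y ^ (-b)) ∂m < ⊤ := by
    refine setLIntegral_lt_top_of_le_nnreal (measure_ne_top _ _)
      ⟨(ρ ^ (-b)).toNNReal, fun x hx ↦ ENNReal.ofReal_le_ofReal ?_⟩
    rw [mem_compl_iff, mem_closedBall, not_le] at hx
    exact Real.rpow_le_rpow_of_nonpos hρ hx.le (neg_nonpos.mpr hb)
  rw [← lintegral_add_compl _ (measurableSet_closedBall (x := y) (ε := ρ))]
  exact ENNReal.add_lt_top.mpr ⟨(hnear y).trans_lt ENNReal.one_lt_top, hfar⟩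

theorem tendsto_setLIntegral_compl_closedBall_zero [IsFiniteMeasure m] (hb : 0 ≤ b)
    {l : Filter X} [l.IsCountablyGenerated] {z : X} (hl : l ≤ 𝓝 z) {C : ℝ≥0} {f : X → X → ℝ≥0∞}
    (hf : ∀ᶠ y in l, AEMeasurable (f y) m)
    (hbound : ∀ᶠ y in l, ∀ᵐ x ∂m,
      f y x ≤ C * (ENNReal.ofReal (dist x y ^ (-b)) + ENNReal.ofReal (dist x z ^ (-b))))
    (hlim : ∀ᵐ x ∂m, Tendsto (f · x) l (𝓝 0)) {ρ : ℝ} (hρ : 0 < ρ) :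
    Tendsto (fun y ↦ ∫⁻ x in (closedBall z ρ)ᶜ, f y x ∂m) l (𝓝 0) := by
  rw [← lintegral_zero (μ := m.restrict (closedBall z ρ)ᶜ)]
  refine tendsto_lintegral_filter_of_dominated_convergence'
    (fun _ ↦ C * (ENNReal.ofReal ((ρ / 2) ^ (-b)) + ENNReal.ofReal ((ρ / 2) ^ (-b))))
    (hf.mono fun y hy ↦ hy.restrict) ?_ ?_ (ae_restrict_of_ae hlim)
  · filter_upwards [hbound, hl (closedBall_mem_nhds z (half_pos hρ))] with y hbound hy
    rw [mem_closedBall] at hy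
    filter_upwards [ae_restrict_of_ae hbound,
      ae_restrict_mem measurableSet_closedBall.compl] with x hxb hx
    rw [mem_compl_iff, mem_closedBall, not_le] at hx
    refine hxb.trans ?_
    gcongr _ * (ENNReal.ofReal ?_ + ENNReal.ofReal ?_) <;>
      refine Real.rpow_le_rpow_of_nonpos (by positivity) ?_ (neg_nonpos.mpr hb)
    · linarith [dist_triangle x y z]
    · linarith
  · simp [lintegral_const, ENNReal.mul_eq_top, measure_ne_top]

/-- A dominated convergence theorem with a moving singularity: near `z` the integrals are
uniformly small, away from `z` the integrands are bounded. -/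
theorem IsUpperRegular.tendsto_lintegral_zero [IsFiniteMeasure m] (hm : IsUpperRegular m d)
    (hb : 0 ≤ b) (hbd : b < d) {l : Filter X} [l.IsCountablyGenerated] {z : X} (hl : l ≤ 𝓝 z)
    {C : ℝ≥0} {f : X → X → ℝ≥0∞} (hf : ∀ᶠ y in l, AEMeasurable (f y) m)
    (hbound : ∀ᶠ y in l, ∀ᵐ x ∂m,
      f y x ≤ C * (ENNReal.ofReal (dist x y ^ (-b)) + ENNReal.ofReal (dist x z ^ (-b))))
    (hlim : ∀ᵐ x ∂m, Tendsto (f · x) l (𝓝 0)) :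
    Tendsto (fun y ↦ ∫⁻ x, f y x ∂m) l (𝓝 0) := by
  refine ENNReal.tendsto_nhds_zero.mpr fun ε hε ↦ ?_
  have hε' : 0 < ε / 2 := ENNReal.half_pos hε.ne'
  obtain ⟨η, hη, hηε⟩ := ENNReal.exists_nnreal_pos_mul_lt (a := C * 2)
    (ENNReal.mul_ne_top ENNReal.coe_ne_top ENNReal.ofNat_ne_top) hε'.ne'
  obtain ⟨ρ, hρ, hsmall⟩ :=
    hm.exists_forall_setLIntegral_rpow_neg_dist_le hb hbd (ENNReal.coe_pos.mpr hη)
  have hnear : ∀ᶠ y in l, ∫⁻ x in closedBall z (ρ / 2), f y x ∂m ≤ ε / 2 := by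
    filter_upwards [hbound, hl (closedBall_mem_nhds z (half_pos hρ))] with y hbound hy
    have hsub : closedBall z (ρ / 2) ⊆ closedBall y ρ :=
      closedBall_subset_closedBall' (by rw [dist_comm]; linarith [mem_closedBall.mp hy])
    calc ∫⁻ x in closedBall z (ρ / 2), f y x ∂m
        ≤ C * (∫⁻ x in closedBall z (ρ / 2), ENNReal.ofReal (dist x y ^ (-b)) ∂m +
          ∫⁻ x in closedBall z (ρ / 2), ENNReal.ofReal (dist x z ^ (-b)) ∂m) := by
          rw [← lintegral_add_left' (by fun_prop), ← lintegral_const_mul' _ _ ENNReal.coe_ne_top]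
          exact lintegral_mono_ae (ae_restrict_of_ae hbound)
      _ ≤ C * (η + η) := by
          gcongr
          · exact (lintegral_mono_set hsub).trans (hsmall y)
          · exact (lintegral_mono_set (closedBall_subset_closedBall (by linarith))).trans (hsmall z)
      _ = η * (C * 2) := by ring
      _ ≤ ε / 2 := hηε.le
  have hfar := tendsto_setLIntegral_compl_closedBall_zero hb hl hf hbound hlim (half_pos hρ)
  filter_upwards [hnear, ENNReal.tendsto_nhds_zero.mp hfar _ hε'] with y h₁ h₂
  rw [← lintegral_add_compl _ (measurableSet_closedBall (x := z) (ε := ρ / 2)),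
    ← ENNReal.add_halves ε]
  exact add_le_add h₁ h₂

end UpperRegular

theorem measurable_ofReal_bdist_rpow (Ω : Set (Eu N)) (a : ℝ) :
    Measurable fun x ↦ ENNReal.ofReal (bdist Ω x ^ a) :=
  ((continuous_bdist Ω).measurable.pow_const a).ennreal_ofReal

theorem IsThinCollarDomain.exists_volume_min_bdist_le (hΩ : IsThinCollarDomain Ω) :
    ∃ C : ℝ≥0, ∀ (y : Eu N) (ρ t : ℝ), t ∈ Ioc 0 ρ →
      volume.restrict (closedBall y ρ ∩ Ω) {x | min (bdist Ω x) ρ ≤ t} ≤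
        C * ENNReal.ofReal (ρ ^ N / ρ) * ENNReal.ofReal t := by
  obtain ⟨C, hC⟩ := hΩ.volume_collar_le
  refine ⟨C + (volume (ball (0 : Eu N) 1)).toNNReal, fun y ρ t ht ↦ ?_⟩
  have hρ : 0 < ρ := ht.1.trans_le ht.2
  rw [Measure.restrict_apply' (measurableSet_closedBall.inter hΩ.isOpen.measurableSet), mul_assoc,
    ← ENNReal.ofReal_mul (by positivity), show ρ ^ N / ρ * t = t / ρ * ρ ^ N by ring,
    ENNReal.coe_add, add_mul]
  rcases ht.2.lt_or_eq with h | rfl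
  · refine le_add_right ((measure_mono fun x hx ↦ ?_).trans (hC y ρ t ht.1 ht.2))
    exact ⟨⟨hx.2.2, (min_le_iff.mp hx.1).resolve_right h.not_ge⟩, hx.2.1⟩
  · refine le_add_left ((measure_mono (inter_subset_right.trans inter_subset_left)).trans_eq ?_)
    rw [Measure.addHaar_closedBall _ _ hρ.le, div_self hρ.ne', one_mul,
      ENNReal.coe_toNNReal measure_ball_lt_top.ne, finrank_euclideanSpace_fin, mul_comm]

theorem IsThinCollarDomain.isUpperRegular_weightedVolume [NeZero N] (hΩ : IsThinCollarDomain Ω)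
    {a : ℝ} (ha : 0 ≤ a) (ha1 : a < 1) : IsUpperRegular (weightedVolume Ω (-a)) (N - a) := by
  obtain ⟨C, hC⟩ := hΩ.exists_volume_min_bdist_le
  have hθ : (2 : ℝ) ^ (a - 1) < 1 := Real.rpow_lt_one_of_one_lt_of_neg one_lt_two (by linarith)
  refine ⟨C * (2 ^ a / (1 - 2 ^ (a - 1)) : ℝ).toNNReal, fun y ρ hρ ↦ ?_⟩
  set B := closedBall y ρ
  have hB : MeasurableSet B := measurableSet_closedBall
  have hmin : ∀ᵐ x ∂volume.restrict (B ∩ Ω), min (bdist Ω x) ρ ∈ Ioc 0 ρ := by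
    filter_upwards [ae_restrict_mem (hB.inter hΩ.isOpen.measurableSet)] with x hx
    exact ⟨lt_min (bdist_pos hΩ.isOpen hΩ.isBounded hx.2) hρ, min_le_right _ _⟩
  have hpow : ρ ^ N / ρ * ρ ^ (1 - a) = ρ ^ ((N : ℝ) - a) := by
    rw [← Real.rpow_natCast, ← Real.rpow_sub_one hρ.ne', ← Real.rpow_add hρ]
    ring_nf
  calc weightedVolume Ω (-a) B
      = ∫⁻ x in B ∩ Ω, ENNReal.ofReal (bdist Ω x ^ (-a)) := by
        rw [weightedVolume, withDensity_apply _ hB, Measure.restrict_restrict hB]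
    _ ≤ ∫⁻ x in B ∩ Ω, ENNReal.ofReal (min (bdist Ω x) ρ ^ (-a)) := by
        refine lintegral_mono_ae (hmin.mono fun x hx ↦ ENNReal.ofReal_le_ofReal ?_)
        exact Real.rpow_le_rpow_of_nonpos hx.1 (min_le_left _ _) (neg_nonpos.mpr ha)
    _ ≤ C * ENNReal.ofReal (ρ ^ N / ρ) *
          ENNReal.ofReal (2 ^ a / (1 - 2 ^ (a - 1)) * ρ ^ (1 - a)) :=
        lintegral_rpow_neg_le_of_measure_le
          ((continuous_bdist Ω).min continuous_const).measurable ha ha1 hρ hmin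
          fun t ht ↦ by simpa only [Real.rpow_one] using hC y ρ t ht
    _ = _ := by
        rw [← hpow, ENNReal.ofReal_mul (div_nonneg (by positivity) (sub_pos.mpr hθ).le),
          ENNReal.ofReal_mul (by positivity), ENNReal.coe_mul, ENNReal.ofNNReal_toNNReal]
        ring

theorem IsThinCollarDomain.isFiniteMeasure_weightedVolume [NeZero N] (hΩ : IsThinCollarDomain Ω)
    {a : ℝ} (ha : 0 ≤ a) (ha1 : a < 1) : IsFiniteMeasure (weightedVolume Ω (-a)) := by
  obtain ⟨C, hC⟩ := hΩ.isUpperRegular_weightedVolume ha ha1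
  obtain ⟨ρ, hρ, hsub⟩ := hΩ.isBounded.subset_closedBall_lt 0 0
  refine ⟨?_⟩
  have hcompl : weightedVolume Ω (-a) Ωᶜ = 0 :=
    withDensity_absolutelyContinuous _ _ (by simp [hΩ.isOpen.measurableSet])
  calc weightedVolume Ω (-a) univ = weightedVolume Ω (-a) Ω :=
      (measure_of_measure_compl_eq_zero hcompl).symm
    _ ≤ weightedVolume Ω (-a) (closedBall 0 ρ) := measure_mono hsub
    _ ≤ C * ENNReal.ofReal (ρ ^ (N - a : ℝ)) := hC 0 ρ hρ
    _ < ⊤ := ENNReal.mul_lt_top ENNReal.coe_lt_top ENNReal.ofReal_lt_top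

/-! ### Bounds for the Green profile -/

theorem min_rpow_mul_min_rpow_le {X Y β γ θ : ℝ} (hX : 0 < X) (hY : 0 < Y) (hXY : X ≤ Y + 1)
    (hβ : 0 ≤ β) (hβγ : β ≤ γ) (hγθ : -γ ≤ θ) (hθβ : θ ≤ β) :
    min X 1 ^ γ * min Y 1 ^ γ ≤ 2 ^ γ * (Y ^ β * X ^ (-θ)) := by
  have hA : 0 < min X 1 := by positivity
  have hB : 0 < min Y 1 := by positivity
  have hγ : 0 ≤ γ := hβ.trans hβγ
  have hBβ : min Y 1 ^ γ ≤ min Y 1 ^ β :=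
    Real.rpow_le_rpow_of_exponent_ge hB (min_le_right _ _) hβγ
  rcases le_total θ 0 with hθ | hθ
  · have hAθ : min X 1 ^ γ ≤ X ^ (-θ) :=
      (Real.rpow_le_rpow_of_exponent_ge hA (min_le_right _ _) (by linarith)).trans
        (Real.rpow_le_rpow hA.le (min_le_left _ _) (by linarith))
    calc min X 1 ^ γ * min Y 1 ^ γ ≤ X ^ (-θ) * Y ^ β := by
          gcongr
          exact hBβ.trans (Real.rpow_le_rpow hB.le (min_le_left _ _) hβ)
      _ = 1 * (Y ^ β * X ^ (-θ)) := by ring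
      _ ≤ 2 ^ γ * (Y ^ β * X ^ (-θ)) := by
          gcongr
          exact Real.one_le_rpow one_le_two hγ
  · have hBX : min Y 1 ≤ 2 * Y / X := by
      rw [le_div_iff₀ hX]
      rcases le_total Y 1 with h | h
      · rw [min_eq_left h]; nlinarith
      · rw [min_eq_right h]; linarith
    calc min X 1 ^ γ * min Y 1 ^ γ ≤ 1 * min Y 1 ^ β := by
          gcongr
          exact Real.rpow_le_one hA.le (min_le_right _ _) hγ
      _ = min Y 1 ^ (β - θ) * min Y 1 ^ θ := by
          rw [one_mul, ← Real.rpow_add hB, sub_add_cancel]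
      _ ≤ Y ^ (β - θ) * (2 * Y / X) ^ θ := by
          gcongr ?_ * ?_
          · exact Real.rpow_le_rpow hB.le (min_le_left _ _) (sub_nonneg.2 hθβ)
          · exact Real.rpow_le_rpow hB.le hBX hθ
      _ = 2 ^ θ * (Y ^ β * X ^ (-θ)) := by
          rw [Real.div_rpow (by positivity) hX.le, Real.mul_rpow zero_le_two hY.le,
            Real.rpow_neg hX.le, ← sub_add_cancel β θ, Real.rpow_add hY, sub_add_cancel]
          ring
      _ ≤ 2 ^ γ * (Y ^ β * X ^ (-θ)) := by
          gcongr
          · exact one_le_two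
          · exact hθβ.trans hβγ

theorem greenProfile_mul_bdist_rpow_le {s β γ θ : ℝ} {x y : Eu N} (hxy : x ≠ y)
    (hx : 0 < bdist Ω x) (hy : 0 < bdist Ω y) (hβ : 0 ≤ β) (hβγ : β ≤ γ) (hγθ : -γ ≤ θ)
    (hθβ : θ ≤ β) :
    greenProfile Ω s γ x y * bdist Ω y ^ (-β) ≤
      2 ^ γ * (‖x - y‖ ^ (-(N - 2 * s + β - θ)) * bdist Ω x ^ (-θ)) := by
  have hr : 0 < ‖x - y‖ := norm_sub_pos_iff.2 hxy
  have hXY : bdist Ω x / ‖x - y‖ ≤ bdist Ω y / ‖x - y‖ + 1 := by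
    rw [div_add_one hr.ne']
    gcongr
    exact bdist_le_add Ω x y
  rw [greenProfile, mul_assoc (1 / _)]
  calc 1 / ‖x - y‖ ^ ((N : ℝ) - 2 * s) *
        (min (bdist Ω x / ‖x - y‖) 1 ^ γ * min (bdist Ω y / ‖x - y‖) 1 ^ γ) * bdist Ω y ^ (-β)
      ≤ 1 / ‖x - y‖ ^ ((N : ℝ) - 2 * s) *
        (2 ^ γ * ((bdist Ω y / ‖x - y‖) ^ β * (bdist Ω x / ‖x - y‖) ^ (-θ))) *
          bdist Ω y ^ (-β) := by
        refine mul_le_mul_of_nonneg_right (mul_le_mul_of_nonneg_left ?_ (by positivity))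
          (by positivity)
        exact min_rpow_mul_min_rpow_le (by positivity) (by positivity) hXY hβ hβγ hγθ hθβ
    _ = 2 ^ γ * (‖x - y‖ ^ (-(N - 2 * s + β - θ)) * bdist Ω x ^ (-θ)) := by
        have hsplit : -(N - 2 * s + β - θ) = -(N - 2 * s) + -β + θ := by ring
        rw [hsplit, Real.rpow_add hr, Real.rpow_add hr, Real.div_rpow hy.le hr.le,
          Real.div_rpow hx.le hr.le]
        simp only [Real.rpow_neg hr.le, Real.rpow_neg hx.le, Real.rpow_neg hy.le]
        field_simp

theorem exists_singularity_exponents {n κ α β γ q : ℝ} (hβ : 0 ≤ β) (hβγ : β ≤ γ)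
    (hα : -β - 1 < α) (hq : 1 ≤ q) (hqκ : q * κ < n) (hqα : q * (κ + β) < n + α) :
    ∃ θ a : ℝ, -γ ≤ θ ∧ θ ≤ β ∧ 0 ≤ a ∧ a < 1 ∧ q * θ ≤ α + a ∧ a + q * (κ + β - θ) < n := by
  have hq0 : 0 < q := zero_lt_one.trans_le hq
  rcases le_or_gt (q * β) α with h | h
  · exact ⟨β, 0, by linarith, le_rfl, le_rfl, one_pos, by linarith, by simpa using hqκ⟩
  rcases le_or_gt (-(q * γ)) α with h' | h'
  · have hqθ : q * (α / q) = α := mul_div_cancel₀ _ hq0.ne'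
    refine ⟨α / q, 0, ?_, ?_, le_rfl, one_pos, by linarith, by linarith⟩
    · rw [le_div_iff₀ hq0]; linarith
    · rw [div_le_iff₀ hq0]; linarith
  · exact ⟨-γ, -(α + q * γ), le_rfl, by linarith, by linarith, by nlinarith, by linarith,
      by linarith⟩

/-! ### Integral operators on finite measures -/

section IntegralOperators

variable {X Y : Type*} [MeasurableSpace X] [MeasurableSpace Y] {m : Measure X} {p : ℝ≥0∞}

theorem totallyBounded_of_forall_exists_edist_le {Z : Type*} [PseudoEMetricSpace Z] {T : Set Z}
    (h : ∀ ε : ℝ≥0, 0 < ε → ∃ A, TotallyBounded A ∧ ∀ u ∈ T, ∃ v ∈ A, edist u v ≤ ε) :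
    TotallyBounded T := by
  rw [EMetric.totallyBounded_iff]
  intro ε hε
  obtain ⟨η, hη, hηε⟩ := ENNReal.lt_iff_exists_nnreal_btwn.1 (ENNReal.half_pos hε.ne')
  obtain ⟨A, hA, hTA⟩ := h η (by exact_mod_cast hη)
  obtain ⟨t, ht, hAt⟩ := EMetric.totallyBounded_iff.1 hA (ε / 2) (ENNReal.half_pos hε.ne')
  refine ⟨t, ht, fun u hu ↦ ?_⟩
  obtain ⟨v, hv, huv⟩ := hTA u hu
  obtain ⟨w, hw, hvw⟩ := mem_iUnion₂.1 (hAt hv)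
  refine mem_iUnion₂.2 ⟨w, hw, ?_⟩
  calc edist u w ≤ edist u v + edist v w := edist_triangle u v w
    _ < ε / 2 + ε / 2 := ENNReal.add_lt_add (huv.trans_lt hηε) hvw
    _ = ε := ENNReal.add_halves ε

theorem exists_simpleFunc_forall_mem [TopologicalSpace Y] [OpensMeasurableSpace Y] {Z : Type*}
    [Nonempty Z] {r : Y → Z → Prop} {S U : Set Y} (hS : IsCompact S)
    (hr : ∀ z ∈ S, ∃ k, ∀ᶠ y in 𝓝[U] z, r y k) :
    ∃ g : SimpleFunc Y Z, ∀ y ∈ U ∩ S, r y (g y) := by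
  classical
  suffices ∃ V, MeasurableSet V ∧ S ⊆ V ∧ ∃ g : SimpleFunc Y Z, ∀ y ∈ U ∩ V, r y (g y) by
    obtain ⟨V, -, hSV, g, hg⟩ := this
    exact ⟨g, fun y hy ↦ hg y ⟨hy.1, hSV hy.2⟩⟩
  refine hS.induction_on
    (p := fun S ↦ ∃ V, MeasurableSet V ∧ S ⊆ V ∧ ∃ g : SimpleFunc Y Z, ∀ y ∈ U ∩ V, r y (g y))
    ?_ ?_ ?_ ?_
  · exact ⟨∅, .empty, subset_rfl, .const Y (Classical.arbitrary Z), by simp⟩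
  · rintro S T hST ⟨V, hV, hTV, hg⟩
    exact ⟨V, hV, hST.trans hTV, hg⟩
  · rintro S T ⟨V, hV, hSV, g, hg⟩ ⟨W, hW, hTW, h, hh⟩
    refine ⟨V ∪ W, hV.union hW, union_subset_union hSV hTW, g.piecewise V hV h, ?_⟩
    rintro y ⟨hyU, hy⟩
    by_cases hyV : y ∈ V
    · simpa [hyV] using hg y ⟨hyU, hyV⟩
    · simpa [hyV] using hh y ⟨hyU, hy.resolve_left hyV⟩
  · intro z hz
    obtain ⟨k, hk⟩ := hr z hz
    obtain ⟨V, hV, hzV, hVU⟩ := mem_nhdsWithin.1 hk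
    exact ⟨V, mem_nhdsWithin_of_mem_nhds (hV.mem_nhds hzV), V, hV.measurableSet, subset_rfl,
      .const Y k, fun y hy ↦ hVU hy.symm⟩

theorem lintegral_rpow_le_lintegral_rpow_mul {ν : Measure Y} {f : Y → ℝ≥0∞}
    (hf : AEMeasurable f ν) {q : ℝ} (hq : 1 ≤ q) :
    (∫⁻ y, f y ∂ν) ^ q ≤ (∫⁻ y, f y ^ q ∂ν) * ν univ ^ (q - 1) := by
  have hq0 : 0 < q := one_pos.trans_le hq
  have h := eLpNorm'_le_eLpNorm'_mul_rpow_measure_univ one_pos hq hf.aestronglyMeasurable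
  simp only [eLpNorm', enorm_eq_self, ENNReal.rpow_one, div_one] at h
  calc (∫⁻ y, f y ∂ν) ^ q
      ≤ ((∫⁻ y, f y ^ q ∂ν) ^ (1 / q) * ν univ ^ (1 - 1 / q)) ^ q := by gcongr
    _ = (∫⁻ y, f y ^ q ∂ν) * ν univ ^ (q - 1) := by
        rw [ENNReal.mul_rpow_of_nonneg _ _ hq0.le, ← ENNReal.rpow_mul, ← ENNReal.rpow_mul,
          one_div_mul_cancel hq0.ne', ENNReal.rpow_one, sub_mul, one_div_mul_cancel hq0.ne',
          one_mul]

theorem eLpNorm_lintegral_le [SFinite m] {ν : Measure Y} [IsFiniteMeasure ν] (hp1 : 1 ≤ p)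
    (hp : p ≠ ⊤) {f : X → Y → ℝ≥0∞} (hf : Measurable (Function.uncurry f)) {B : ℝ≥0∞}
    (hB : ∀ᵐ y ∂ν, eLpNorm (fun x ↦ f x y) p m ≤ B) :
    eLpNorm (fun x ↦ ∫⁻ y, f x y ∂ν) p m ≤ B * ν univ := by
  have hp0 : p ≠ 0 := (one_pos.trans_le hp1).ne'
  have hq1 : 1 ≤ p.toReal := by
    rw [← ENNReal.toReal_one]; exact ENNReal.toReal_mono hp hp1
  set q := p.toReal
  have hq0 : 0 < q := one_pos.trans_le hq1
  have eLpNorm_le_iff {Z : Type _} [MeasurableSpace Z] {μ : Measure Z} {g : Z → ℝ≥0∞} {b : ℝ≥0∞} :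
      eLpNorm g p μ ≤ b ↔ ∫⁻ z, g z ^ q ∂μ ≤ b ^ q := by
    rw [eLpNorm_eq_lintegral_rpow_enorm_toReal hp0 hp, one_div, ENNReal.rpow_inv_le_iff hq0]
    rfl
  rw [eLpNorm_le_iff]
  calc ∫⁻ x, (∫⁻ y, f x y ∂ν) ^ q ∂m
      ≤ ∫⁻ x, (∫⁻ y, f x y ^ q ∂ν) * ν univ ^ (q - 1) ∂m := lintegral_mono fun x ↦
        lintegral_rpow_le_lintegral_rpow_mul hf.of_uncurry_left.aemeasurable hq1
    _ = (∫⁻ y, ∫⁻ x, f x y ^ q ∂m ∂ν) * ν univ ^ (q - 1) := by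
        have hfq : Measurable (Function.uncurry fun x y ↦ f x y ^ q) := hf.pow_const q
        have hfq_int : Measurable fun x ↦ ∫⁻ y, f x y ^ q ∂ν := hfq.lintegral_prod_right'
        rw [lintegral_mul_const _ hfq_int,
          lintegral_lintegral_swap hfq.aemeasurable]
    _ ≤ (∫⁻ _, B ^ q ∂ν) * ν univ ^ (q - 1) := by
        gcongr ?_ * _
        refine lintegral_mono_ae ?_
        filter_upwards [hB] with y hy using eLpNorm_le_iff.1 hy
    _ = (B * ν univ) ^ q := by
        rw [lintegral_const, ENNReal.mul_rpow_of_nonneg _ _ hq0.le, mul_assoc]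
        nth_rw 1 [← ENNReal.rpow_one (ν univ)]
        rw [← ENNReal.rpow_add_of_nonneg _ _ zero_le_one (sub_nonneg.2 hq1), add_sub_cancel]

theorem eLpNorm_integral_le [SFinite m] {ν : Measure Y} [IsFiniteMeasure ν] (hp1 : 1 ≤ p)
    (hp : p ≠ ⊤) {K : X → Y → ℝ} (hK : Measurable (Function.uncurry K)) {B : ℝ≥0∞}
    (hB : ∀ᵐ y ∂ν, eLpNorm (fun x ↦ K x y) p m ≤ B) :
    eLpNorm (fun x ↦ ∫ y, K x y ∂ν) p m ≤ B * ν univ := by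
  refine (eLpNorm_mono_enorm fun x ↦ enorm_integral_le_lintegral_enorm _).trans
    (eLpNorm_lintegral_le hp1 hp (f := fun x y ↦ ‖K x y‖ₑ) hK.enorm ?_)
  simpa only [eLpNorm_enorm] using hB

theorem ae_integrable_of_eLpNorm_le [SFinite m] {ν : Measure Y} [IsFiniteMeasure ν] (hp1 : 1 ≤ p)
    (hp : p ≠ ⊤) {K : X → Y → ℝ} (hK : Measurable (Function.uncurry K)) {B : ℝ≥0}
    (hB : ∀ᵐ y ∂ν, eLpNorm (fun x ↦ K x y) p m ≤ B) :
    ∀ᵐ x ∂m, Integrable (K x) ν := by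
  have hp0 : p ≠ 0 := (one_pos.trans_le hp1).ne'
  have hq0 : 0 < p.toReal := ENNReal.toReal_pos hp0 hp
  have hfin : eLpNorm (fun x ↦ ∫⁻ y, ‖K x y‖ₑ ∂ν) p m < ⊤ :=
    (eLpNorm_lintegral_le hp1 hp (f := fun x y ↦ ‖K x y‖ₑ) hK.enorm
      (by simpa only [eLpNorm_enorm] using hB)).trans_lt
      (ENNReal.mul_lt_top ENNReal.coe_lt_top (measure_lt_top _ _))
  have hmeas : Measurable fun x ↦ ∫⁻ y, ‖K x y‖ₑ ∂ν := hK.enorm.lintegral_prod_right'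
  filter_upwards [ae_lt_top (hmeas.pow_const _)
    (lintegral_rpow_enorm_lt_top_of_eLpNorm_lt_top hp0 hp hfin).ne] with x hx
  exact ⟨hK.of_uncurry_left.aestronglyMeasurable, (ENNReal.rpow_lt_top_iff_of_pos hq0).1 hx⟩

/-- The slices `K(·, y)`, `y ∈ U`, of a kernel are approximated in `L^p(m)`, uniformly in `y`, by
functions of `y` with finitely many values in `L^p(m)`. For the operator `ν ↦ ∫ K(·, y) dν(y)` on
finite measures this plays the role that approximability by finite rank operators plays for bounded
operators. -/
def IsSliceApproximable (K : X → Y → ℝ) (p : ℝ≥0∞) (m : Measure X) (U : Set Y) : Prop :=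
  ∀ ε : ℝ≥0, 0 < ε → ∃ g : SimpleFunc Y (Lp ℝ p m),
    ∀ y ∈ U, eLpNorm (fun x ↦ K x y - g y x) p m ≤ ε

theorem IsSliceApproximable.of_tendsto [TopologicalSpace Y] [OpensMeasurableSpace Y]
    {K : X → Y → ℝ} {S U : Set Y} (hS : IsCompact S) (hUS : U ⊆ S)
    (hlim : ∀ z ∈ S, ∃ k : X → ℝ, MemLp k p m ∧
      Tendsto (fun y ↦ eLpNorm (fun x ↦ K x y - k x) p m) (𝓝[U] z) (𝓝 0)) :
    IsSliceApproximable K p m U := by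
  intro ε hε
  obtain ⟨g, hg⟩ := exists_simpleFunc_forall_mem (U := U) hS
    (r := fun y (f : Lp ℝ p m) ↦ eLpNorm (fun x ↦ K x y - f x) p m ≤ ε) fun z hz ↦ by
      obtain ⟨k, hk, hkz⟩ := hlim z hz
      refine ⟨hk.toLp k, ?_⟩
      filter_upwards [hkz.eventually_le_const (u := (ε : ℝ≥0∞)) (by exact_mod_cast hε)] with y hy
      refine (eLpNorm_congr_ae ?_).trans_le hy
      filter_upwards [hk.coeFn_toLp] with x hx
      rw [hx]
  exact ⟨g, fun y hy ↦ hg y ⟨hy, hUS hy⟩⟩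

theorem measurable_uncurry_simpleFunc_Lp (g : SimpleFunc Y (Lp ℝ p m)) :
    Measurable (Function.uncurry fun x y ↦ g y x) :=
  (g.comp (Prod.snd : X × Y → Y) measurable_snd).measurable_bind (fun f z ↦ f z.1)
    fun f ↦ (Lp.stronglyMeasurable f).measurable.comp measurable_fst

theorem coeFn_sum_smul (t : Finset (Lp ℝ p m)) (c : Lp ℝ p m → ℝ) :
    ⇑(∑ f ∈ t, c f • f) =ᵐ[m] fun x ↦ ∑ f ∈ t, c f • f x := by
  classical
  induction t using Finset.induction_on with
  | empty => exact Lp.coeFn_zero ℝ p m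
  | insert f t hf ih =>
    rw [Finset.sum_insert hf]
    filter_upwards [ih, Lp.coeFn_add (c f • f) (∑ f ∈ t, c f • f), Lp.coeFn_smul (c f) f]
      with x hx hadd hsmul
    rw [hadd, Pi.add_apply, hx, hsmul, Pi.smul_apply, Finset.sum_insert hf]

theorem coeFn_simpleFunc_integral [Fact (1 ≤ p)] {ν : Measure Y} [IsFiniteMeasure ν]
    (g : SimpleFunc Y (Lp ℝ p m)) :
    ⇑(g.integral ν) =ᵐ[m] fun x ↦ ∫ y, g y x ∂ν := by
  rw [g.integral_eq]
  filter_upwards [coeFn_sum_smul g.range fun f ↦ ν.real (g ⁻¹' {f}), Lp.coeFn_zero ℝ p m]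
    with x hx hx0
  rw [hx, ← SimpleFunc.map_integral g (fun f ↦ f x) g.integrable_of_isFiniteMeasure hx0,
    SimpleFunc.integral_eq_integral _ (SimpleFunc.integrable_of_isFiniteMeasure _)]
  rfl

theorem totallyBounded_setOf_simpleFunc_integral [Fact (1 ≤ p)] (g : SimpleFunc Y (Lp ℝ p m))
    (R : ℝ≥0) :
    TotallyBounded {f | ∃ ν : Measure Y, ν univ ≤ R ∧ f = g.integral ν} := by
  have hbox : IsCompact ((fun c : Lp ℝ p m → ℝ ↦ ∑ f ∈ g.range, c f • f) '' Icc 0 fun _ ↦ R) :=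
    isCompact_Icc.image (by fun_prop)
  refine hbox.totallyBounded.subset ?_
  rintro _ ⟨ν, hν, rfl⟩
  refine ⟨fun f ↦ ν.real (g ⁻¹' {f}), ⟨fun _ ↦ measureReal_nonneg, fun f ↦ ?_⟩, rfl⟩
  exact ENNReal.toReal_le_coe_of_le_coe ((measure_mono (subset_univ _)).trans hν)

namespace IsSliceApproximable

variable {K : X → Y → ℝ} {U : Set Y}

theorem exists_eLpNorm_le (h : IsSliceApproximable K p m U) (hp : 1 ≤ p)
    (hK : Measurable (Function.uncurry K)) :
    ∃ B : ℝ≥0, ∀ y ∈ U, eLpNorm (fun x ↦ K x y) p m ≤ B := by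
  have := Fact.mk hp
  obtain ⟨g, hg⟩ := h 1 one_pos
  obtain ⟨C, hC⟩ := g.exists_forall_norm_le
  refine ⟨1 + C.toNNReal, fun y hy ↦ ?_⟩
  have hgy : eLpNorm (g y) p m ≤ C.toNNReal := by
    rw [← Lp.enorm_def, ← ofReal_norm]
    exact ENNReal.ofReal_le_ofReal (hC y)
  have hKy : AEStronglyMeasurable (fun x ↦ K x y - g y x) m :=
    hK.of_uncurry_right.aestronglyMeasurable.sub (Lp.aestronglyMeasurable _)
  calc eLpNorm (fun x ↦ K x y) p m = eLpNorm ((fun x ↦ K x y - g y x) + ⇑(g y)) p m := by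
        congr with x
        simp
    _ ≤ eLpNorm (fun x ↦ K x y - g y x) p m + eLpNorm (g y) p m :=
        eLpNorm_add_le hKy (Lp.aestronglyMeasurable _) hp
    _ ≤ (1 + C.toNNReal : ℝ≥0) := by
        push_cast
        exact add_le_add (hg y hy) hgy

variable [SFinite m] {ν : Measure Y} [IsFiniteMeasure ν]

theorem ae_integrable (h : IsSliceApproximable K p m U) (hp1 : 1 ≤ p) (hp : p ≠ ⊤)
    (hK : Measurable (Function.uncurry K)) (hν : ∀ᵐ y ∂ν, y ∈ U) : ∀ᵐ x ∂m, Integrable (K x) ν := by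
  obtain ⟨B, hB⟩ := h.exists_eLpNorm_le hp1 hK
  exact ae_integrable_of_eLpNorm_le hp1 hp hK (hν.mono hB)

theorem memLp_integral (h : IsSliceApproximable K p m U) (hp1 : 1 ≤ p) (hp : p ≠ ⊤)
    (hK : Measurable (Function.uncurry K)) (hν : ∀ᵐ y ∂ν, y ∈ U) :
    MemLp (fun x ↦ ∫ y, K x y ∂ν) p m := by
  obtain ⟨B, hB⟩ := h.exists_eLpNorm_le hp1 hK
  exact ⟨(hK.stronglyMeasurable.integral_prod_right (ν := ν)).aestronglyMeasurable,
    (eLpNorm_integral_le hp1 hp hK (hν.mono hB)).trans_lt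
      (ENNReal.mul_lt_top ENNReal.coe_lt_top (measure_lt_top _ _))⟩

theorem totallyBounded_setOf_integral [Fact (1 ≤ p)] (h : IsSliceApproximable K p m U)
    (hp : p ≠ ⊤) (hK : Measurable (Function.uncurry K)) (R : ℝ≥0) :
    TotallyBounded {f : Lp ℝ p m | ∃ ν : Measure Y, (∀ᵐ y ∂ν, y ∈ U) ∧ ν univ ≤ R ∧
      f =ᵐ[m] fun x ↦ ∫ y, K x y ∂ν} := by
  have hp1 : 1 ≤ p := Fact.out
  refine totallyBounded_of_forall_exists_edist_le fun ε hε ↦ ?_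
  obtain ⟨g, hg⟩ := h (ε / (R + 1)) (by positivity)
  refine ⟨_, totallyBounded_setOf_simpleFunc_integral g R, ?_⟩
  rintro f ⟨ν, hνU, hνR, hf⟩
  have : IsFiniteMeasure ν := ⟨hνR.trans_lt ENNReal.coe_lt_top⟩
  refine ⟨g.integral ν, ⟨ν, hνR, rfl⟩, ?_⟩
  have hgK : Measurable (Function.uncurry fun x y ↦ K x y - g y x) :=
    hK.sub (measurable_uncurry_simpleFunc_Lp g)
  have hg_int : ∀ x, Integrable (fun y ↦ g y x) ν := fun x ↦
    (g.map fun f : Lp ℝ p m ↦ f x).integrable_of_isFiniteMeasure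
  calc edist f (g.integral ν) = eLpNorm (fun x ↦ ∫ y, (K x y - g y x) ∂ν) p m := by
        rw [Lp.edist_def]
        refine eLpNorm_congr_ae ?_
        filter_upwards [hf, coeFn_simpleFunc_integral (ν := ν) g,
          h.ae_integrable hp1 hp hK hνU]
          with x hfx hgx hKx
        rw [Pi.sub_apply, hfx, hgx, integral_sub hKx (hg_int x)]
    _ ≤ (ε / (R + 1) : ℝ≥0) * ν univ := eLpNorm_integral_le hp1 hp hgK (hνU.mono hg)
    _ ≤ (ε / (R + 1) : ℝ≥0) * ((R + 1 : ℝ≥0) : ℝ≥0∞) := by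
        gcongr
        exact hνR.trans (by exact_mod_cast le_self_add)
    _ = ε := by rw [← ENNReal.coe_mul, div_mul_cancel₀ _ (by positivity)]

theorem exists_subseq_tendsto (h : IsSliceApproximable K p m U) (hp1 : 1 ≤ p) (hp : p ≠ ⊤)
    (hK : Measurable (Function.uncurry K)) {R : ℝ≥0∞} (hR : R < ⊤) {ν₁ ν₂ : ℕ → Measure Y}
    (hU₁ : ∀ n, ∀ᵐ y ∂ν₁ n, y ∈ U) (hU₂ : ∀ n, ∀ᵐ y ∂ν₂ n, y ∈ U)
    (hR₁ : ∀ n, ν₁ n univ ≤ R) (hR₂ : ∀ n, ν₂ n univ ≤ R) :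
    ∃ k : ℕ → ℕ, StrictMono k ∧ ∃ u : X → ℝ, MemLp u p m ∧
      Tendsto (fun n ↦ eLpNorm
        (fun x ↦ (∫ y, K x y ∂ν₁ (k n) - ∫ y, K x y ∂ν₂ (k n)) - u x) p m) atTop (𝓝 0) := by
  have := Fact.mk hp1
  lift R to ℝ≥0 using hR.ne
  have (n : ℕ) : IsFiniteMeasure (ν₁ n) := ⟨(hR₁ n).trans_lt hR⟩
  have (n : ℕ) : IsFiniteMeasure (ν₂ n) := ⟨(hR₂ n).trans_lt hR⟩
  have hf₁ n := h.memLp_integral hp1 hp hK (hU₁ n)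
  have hf₂ n := h.memLp_integral hp1 hp hK (hU₂ n)
  set T := {f : Lp ℝ p m | ∃ ν : Measure Y, (∀ᵐ y ∂ν, y ∈ U) ∧ ν univ ≤ R ∧
    f =ᵐ[m] fun x ↦ ∫ y, K x y ∂ν}
  have hT : IsCompact (closure T) :=
    (h.totallyBounded_setOf_integral hp hK R).closure.isCompact_of_isClosed isClosed_closure
  have hfT n : ((hf₁ n).toLp, (hf₂ n).toLp) ∈ closure T ×ˢ closure T :=
    ⟨subset_closure ⟨ν₁ n, hU₁ n, hR₁ n, (hf₁ n).coeFn_toLp⟩,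
      subset_closure ⟨ν₂ n, hU₂ n, hR₂ n, (hf₂ n).coeFn_toLp⟩⟩
  obtain ⟨u, -, k, hk, huk⟩ := (hT.prod hT).tendsto_subseq hfT
  have hsub : Tendsto (fun n ↦ (hf₁ (k n)).toLp - (hf₂ (k n)).toLp) atTop (𝓝 (u.1 - u.2)) :=
    huk.fst_nhds.sub huk.snd_nhds
  refine ⟨k, hk, u.1 - u.2, (Lp.memLp u.1).sub (Lp.memLp u.2), ?_⟩
  refine ((Lp.tendsto_Lp_iff_tendsto_eLpNorm' _ _).1 hsub).congr fun n ↦ eLpNorm_congr_ae ?_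
  filter_upwards [(hf₁ (k n)).coeFn_toLp, (hf₂ (k n)).coeFn_toLp, Lp.coeFn_sub u.1 u.2,
    Lp.coeFn_sub (hf₁ (k n)).toLp (hf₂ (k n)).toLp] with x h₁ h₂ hu h₁₂
  simp only [Pi.sub_apply, h₁₂, h₁, h₂, hu]

end IsSliceApproximable

end IntegralOperators

/-! ### Weakly singular kernels -/

section WeaklySingular

variable {α q a b : ℝ}

theorem ae_weightedVolume [NeZero N] (ho : IsOpen Ω) (hb : Bornology.IsBounded Ω) (α : ℝ) :
    ae (weightedVolume Ω α) = ae (volume.restrict Ω) := by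
  refine (withDensity_absolutelyContinuous _ _).ae_le.antisymm ?_
  refine (withDensity_absolutelyContinuous' (measurable_ofReal_bdist_rpow Ω α).aemeasurable
    ?_).ae_le
  filter_upwards [ae_restrict_mem ho.measurableSet] with x hx
  exact (ENNReal.ofReal_pos.2 (Real.rpow_pos_of_pos (bdist_pos ho hb hx) α)).ne'

theorem weightedVolume_eq_withDensity [NeZero N] (ho : IsOpen Ω) (hb : Bornology.IsBounded Ω)
    (α a : ℝ) :
    weightedVolume Ω α =
      (weightedVolume Ω (-a)).withDensity fun x ↦ ENNReal.ofReal (bdist Ω x ^ (α + a)) := by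
  rw [weightedVolume, weightedVolume, ← withDensity_mul _ (measurable_ofReal_bdist_rpow Ω _)
    (measurable_ofReal_bdist_rpow Ω _)]
  refine withDensity_congr_ae ?_
  filter_upwards [ae_restrict_mem ho.measurableSet] with x hx
  have hδ := bdist_pos ho hb hx
  rw [Pi.mul_apply, ← ENNReal.ofReal_mul (by positivity), ← Real.rpow_add hδ,
    add_comm α a, neg_add_cancel_left]

theorem eLpNorm_weightedVolume [NeZero N] (ho : IsOpen Ω) (hb : Bornology.IsBounded Ω)
    (hq : 0 < q) (α a : ℝ) (f : Eu N → ℝ) :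
    eLpNorm f (ENNReal.ofReal q) (weightedVolume Ω α) =
      (∫⁻ x, ENNReal.ofReal (|f x| ^ q * bdist Ω x ^ (α + a))
        ∂weightedVolume Ω (-a)) ^ (1 / q) := by
  rw [eLpNorm_eq_lintegral_rpow_enorm_toReal (ENNReal.ofReal_pos.2 hq).ne' ENNReal.ofReal_ne_top,
    ENNReal.toReal_ofReal hq.le, weightedVolume_eq_withDensity ho hb α a,
    lintegral_withDensity_eq_lintegral_mul_non_measurable _ (measurable_ofReal_bdist_rpow Ω _)
      (by simp)]
  congr with x
  rw [Pi.mul_apply, mul_comm, ENNReal.ofReal_mul (by positivity), ← Real.norm_eq_abs,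
    ← ENNReal.ofReal_rpow_of_nonneg (norm_nonneg _) hq.le, ofReal_norm]

/-- The singularity of `f` at `z`, measured in `L^q(Ω, δ^α)` against the measure `δ^{-a} dx`, has
order at most `b`: up to the constant `C`, `|f|^q δ^α` is bounded by `δ^{-a} |x - z|^{-b}`. -/
def HasSingularBound (Ω : Set (Eu N)) (α q a b : ℝ) (C : ℝ≥0) (z : Eu N) (f : Eu N → ℝ) : Prop :=
  ∀ᵐ x ∂volume.restrict Ω, |f x| ^ q * bdist Ω x ^ (α + a) ≤ C * dist x z ^ (-b)

variable {C : ℝ≥0} {z : Eu N} {f : Eu N → ℝ} {K : Eu N → Eu N → ℝ}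

theorem HasSingularBound.memLp [NeZero N] (h : HasSingularBound Ω α q a b C z f)
    (hΩ : IsThinCollarDomain Ω) (hf : AEStronglyMeasurable f (weightedVolume Ω α)) (hq : 0 < q)
    (ha : 0 ≤ a) (ha1 : a < 1) (hb : 0 ≤ b) (hab : a + b < N) :
    MemLp f (ENNReal.ofReal q) (weightedVolume Ω α) := by
  have := hΩ.isFiniteMeasure_weightedVolume ha ha1
  refine ⟨hf, ?_⟩
  rw [eLpNorm_weightedVolume hΩ.isOpen hΩ.isBounded hq α a]
  refine ENNReal.rpow_lt_top_of_nonneg (by positivity) (ne_of_lt ?_)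
  calc ∫⁻ x, ENNReal.ofReal (|f x| ^ q * bdist Ω x ^ (α + a)) ∂weightedVolume Ω (-a)
      ≤ ∫⁻ x, C * ENNReal.ofReal (dist x z ^ (-b)) ∂weightedVolume Ω (-a) := by
        refine lintegral_mono_ae ?_
        rw [ae_weightedVolume hΩ.isOpen hΩ.isBounded]
        filter_upwards [h] with x hx
        rw [← ENNReal.ofReal_coe_nnreal, ← ENNReal.ofReal_mul C.coe_nonneg]
        exact ENNReal.ofReal_le_ofReal hx
    _ = C * ∫⁻ x, ENNReal.ofReal (dist x z ^ (-b)) ∂weightedVolume Ω (-a) :=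
        lintegral_const_mul' _ _ ENNReal.coe_ne_top
    _ < ⊤ := ENNReal.mul_lt_top ENNReal.coe_lt_top <|
        (hΩ.isUpperRegular_weightedVolume ha ha1).lintegral_rpow_neg_dist_lt_top hb
          (by linarith) z

theorem HasSingularBound.of_tendsto [NeZero N] (hq : 0 < q)
    (h : ∀ y ∈ Ω, HasSingularBound Ω α q a b C y (K · y)) (hz : z ∈ closure Ω)
    (hlim : ∀ᵐ x ∂volume.restrict Ω, Tendsto (K x) (𝓝[Ω] z) (𝓝 (f x))) :
    HasSingularBound Ω α q a b C z f := by
  have := mem_closure_iff_nhdsWithin_neBot.1 hz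
  obtain ⟨u, hu, huz⟩ : ∃ u : ℕ → Eu N, (∀ n, u n ∈ Ω) ∧ Tendsto u atTop (𝓝 z) :=
    mem_closure_iff_seq_limit.1 hz
  have huΩ : Tendsto u atTop (𝓝[Ω] z) := tendsto_nhdsWithin_iff.2 ⟨huz, .of_forall hu⟩
  filter_upwards [ae_all_iff.2 fun n ↦ h (u n) (hu n), hlim,
    ae_restrict_of_ae (Measure.ae_ne volume z)] with x hx hxlim hxz
  refine le_of_tendsto_of_tendsto
    ((((hxlim.comp huΩ).abs.rpow_const (Or.inr hq.le))).mul_const _) ?_ (.of_forall hx)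
  exact ((tendsto_const_nhds.dist huz).rpow_const (Or.inl (dist_ne_zero.2 hxz))).const_mul _

theorem abs_sub_rpow_mul_le (hq : 1 ≤ q) {u v w U V : ℝ} (hw : 0 ≤ w) (hu : |u| ^ q * w ≤ U)
    (hv : |v| ^ q * w ≤ V) : |u - v| ^ q * w ≤ 2 ^ (q - 1) * (U + V) := by
  have hconv : (|u| + |v|) ^ q ≤ 2 ^ (q - 1) * (|u| ^ q + |v| ^ q) :=
    mod_cast NNReal.rpow_add_le_mul_rpow_add_rpow (Real.nnabs u) (Real.nnabs v) hq
  calc |u - v| ^ q * w ≤ (2 ^ (q - 1) * (|u| ^ q + |v| ^ q)) * w := by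
        gcongr
        exact (Real.rpow_le_rpow (abs_nonneg _) (abs_sub _ _) (by linarith)).trans hconv
    _ ≤ 2 ^ (q - 1) * (U + V) := by
        rw [mul_assoc, add_mul]
        gcongr

theorem tendsto_eLpNorm_sub_of_hasSingularBound [NeZero N] (hΩ : IsThinCollarDomain Ω)
    (hq : 1 ≤ q) (ha : 0 ≤ a) (ha1 : a < 1) (hb : 0 ≤ b) (hab : a + b < N)
    (hK : Measurable (Function.uncurry K)) (hf : Measurable f)
    (h : ∀ y ∈ Ω, HasSingularBound Ω α q a b C y (K · y)) (hz : z ∈ closure Ω)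
    (hlim : ∀ᵐ x ∂volume.restrict Ω, Tendsto (K x) (𝓝[Ω] z) (𝓝 (f x))) :
    Tendsto (fun y ↦ eLpNorm (fun x ↦ K x y - f x) (ENNReal.ofReal q) (weightedVolume Ω α))
      (𝓝[Ω] z) (𝓝 0) := by
  have hq0 : 0 < q := one_pos.trans_le hq
  have := hΩ.isFiniteMeasure_weightedVolume ha ha1
  have hae := ae_weightedVolume hΩ.isOpen hΩ.isBounded (-a)
  have hfz : HasSingularBound Ω α q a b C z f := .of_tendsto hq0 h hz hlim
  simp only [eLpNorm_weightedVolume hΩ.isOpen hΩ.isBounded hq0 α a]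
  rw [← ENNReal.zero_rpow_of_pos (one_div_pos.2 hq0)]
  refine (ENNReal.continuous_rpow_const.tendsto _).comp ?_
  refine (hΩ.isUpperRegular_weightedVolume ha ha1).tendsto_lintegral_zero hb (by linarith)
    nhdsWithin_le_nhds (C := 2 ^ (q - 1) * C) (.of_forall fun y ↦ ?_) ?_ ?_
  · have := (continuous_bdist Ω).measurable.pow_const (α + a)
    have := ((hK.of_uncurry_right (y := y)).sub hf).abs.pow_const q
    fun_prop
  · filter_upwards [self_mem_nhdsWithin] with y hy
    rw [hae]
    filter_upwards [h y hy, hfz] with x hxy hxz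
    rw [← ENNReal.ofReal_add (by positivity) (by positivity), ← ENNReal.ofReal_coe_nnreal,
      ← ENNReal.ofReal_mul NNReal.zero_le_coe]
    refine ENNReal.ofReal_le_ofReal ((abs_sub_rpow_mul_le hq ?_ hxy hxz).trans_eq ?_)
    · exact Real.rpow_nonneg (bdist_nonneg Ω x) _
    · push_cast
      ring
  · rw [hae]
    filter_upwards [hlim] with x hx
    have : Tendsto (fun y ↦ |K x y - f x| ^ q * bdist Ω x ^ (α + a)) (𝓝[Ω] z) (𝓝 0) := by
      simpa [hq0.ne'] using
        ((hx.sub_const (f x)).abs.rpow_const (Or.inr hq0.le)).mul_const (bdist Ω x ^ (α + a))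
    simpa using ENNReal.tendsto_ofReal this

theorem isSliceApproximable_of_hasSingularBound [NeZero N] (hΩ : IsThinCollarDomain Ω)
    (hq : 1 ≤ q) (ha : 0 ≤ a) (ha1 : a < 1) (hb : 0 ≤ b) (hab : a + b < N)
    (hK : Measurable (Function.uncurry K))
    (h : ∀ y ∈ Ω, HasSingularBound Ω α q a b C y (K · y))
    (hlim : ∀ z ∈ closure Ω, ∀ x ∈ Ω, x ≠ z → ∃ κ, Tendsto (K x) (𝓝[Ω] z) (𝓝 κ)) :
    IsSliceApproximable K (ENNReal.ofReal q) (weightedVolume Ω α) Ω := by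
  refine .of_tendsto hΩ.isBounded.isCompact_closure subset_closure fun z hz ↦ ?_
  have := mem_closure_iff_nhdsWithin_neBot.1 hz
  choose! κ hκ using hlim z hz
  have hκ_ae : ∀ᵐ x ∂volume.restrict Ω, Tendsto (K x) (𝓝[Ω] z) (𝓝 (κ x)) := by
    filter_upwards [ae_restrict_mem hΩ.isOpen.measurableSet,
      ae_restrict_of_ae (Measure.ae_ne volume z)] with x hx hxz using hκ x hx hxz
  obtain ⟨k, hk, hκk⟩ : AEMeasurable κ (volume.restrict Ω) :=
    aemeasurable_of_tendsto_metrizable_ae (𝓝[Ω] z) (f := fun y x ↦ K x y)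
      (fun y ↦ hK.of_uncurry_right.aemeasurable) hκ_ae
  have hlim_ae : ∀ᵐ x ∂volume.restrict Ω, Tendsto (K x) (𝓝[Ω] z) (𝓝 (k x)) := by
    filter_upwards [hκ_ae, hκk] with x hx hxk
    rwa [← hxk]
  refine ⟨k, ?_, tendsto_eLpNorm_sub_of_hasSingularBound hΩ hq ha ha1 hb hab hK hk h hz hlim_ae⟩
  exact (HasSingularBound.of_tendsto (one_pos.trans_le hq) h hz hlim_ae).memLp hΩ
    hk.aestronglyMeasurable (one_pos.trans_le hq) ha ha1 hb hab

end WeaklySingular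

/-! ### The Green map -/

section GreenMap

variable {G : Eu N → Eu N → ℝ} {β α q : ℝ} {μ : Measure (Eu N)}

/-- The kernel `G(x, y) δ(y)^{-β}` of the Green map in terms of the finite measure `δ^β μ`, extended
by zero off `(Ω × Ω) ∖ D_Ω` to make it measurable on the whole space. -/
noncomputable def normalizedKernel (Ω : Set (Eu N)) (G : Eu N → Eu N → ℝ) (β : ℝ) (x y : Eu N) :
    ℝ :=
  (offDiagonal Ω).indicator (Function.uncurry G) (x, y) * bdist Ω y ^ (-β)

theorem normalizedKernel_of_mem {x y : Eu N} (hx : x ∈ Ω) (hy : y ∈ Ω) (hxy : x ≠ y) :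
    normalizedKernel Ω G β x y = G x y * bdist Ω y ^ (-β) := by
  have hmem : (x, y) ∈ offDiagonal Ω := ⟨hx, hy, hxy⟩
  rw [normalizedKernel, indicator_of_mem hmem, Function.uncurry_apply_pair]

theorem measurable_normalizedKernel (ho : IsOpen Ω)
    (hG : Measurable ((offDiagonal Ω).domRestrict (Function.uncurry G))) (β : ℝ) :
    Measurable (Function.uncurry (normalizedKernel Ω G β)) := by
  have hoff : MeasurableSet (offDiagonal Ω) := by
    have : offDiagonal Ω = (Ω ×ˢ Ω) ∩ {p | p.1 = p.2}ᶜ := by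
      ext p
      simp [offDiagonal, and_assoc]
    rw [this]
    exact (ho.measurableSet.prod ho.measurableSet).inter
      (isClosed_eq continuous_fst continuous_snd).measurableSet.compl
  have hind : Measurable ((offDiagonal Ω).indicator (Function.uncurry G)) := by
    refine measurable_of_restrict_of_restrict_compl hoff ?_ ?_
    · rwa [domRestrict_eq_domRestrict_iff.2 eqOn_indicator]
    · rw [domRestrict_eq_domRestrict_iff.2 eqOn_indicator']
      exact measurable_const
  exact hind.mul (((continuous_bdist Ω).measurable.comp measurable_snd).pow_const _)

/-- The measure `δ^β μ`, which is finite when `μ` is a positive element of `𝓜(Ω, δ^β)`. -/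
noncomputable def weightedMeasure (Ω : Set (Eu N)) (β : ℝ) (μ : Measure (Eu N)) :
    Measure (Eu N) :=
  μ.withDensity fun y ↦ ENNReal.ofReal (bdist Ω y ^ β)

theorem ae_mem_weightedMeasure (hμ : μ Ωᶜ = 0) (β : ℝ) : ∀ᵐ y ∂weightedMeasure Ω β μ, y ∈ Ω :=
  withDensity_absolutelyContinuous μ _ hμ

theorem weightedNorm_eq (μ : SignedRadonMeasure Ω) (β : ℝ) :
    μ.weightedNorm β =
      weightedMeasure Ω β μ.posPart univ + weightedMeasure Ω β μ.negPart univ := by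
  rw [weightedMeasure, weightedMeasure, withDensity_apply _ .univ, withDensity_apply _ .univ,
    Measure.restrict_univ, Measure.restrict_univ, ← lintegral_add_measure,
    SignedRadonMeasure.weightedNorm, SignedRadonMeasure.variation,
    Measure.restrict_eq_self_of_ae_mem]
  exact ae_add_measure_iff.2 ⟨μ.posPart_compl, μ.negPart_compl⟩

theorem ae_measure_singleton_eq_zero {X : Type*} [MeasurableSpace X] [MeasurableSingletonClass X]
    (m : Measure X) [NullSingletonClass m] (ν : Measure X) [SFinite ν] : ∀ᵐ x ∂m, ν {x} = 0 := by
  have h := Measure.countable_meas_pos_of_disjoint_iUnion (μ := ν) (As := fun x : X ↦ {x})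
    measurableSet_singleton fun x y hxy ↦ disjoint_singleton.2 hxy
  simpa only [ae_iff, pos_iff_ne_zero] using h.measure_zero m

theorem ae_smul_normalizedKernel_eq [NeZero N] (ho : IsOpen Ω) (hb : Bornology.IsBounded Ω)
    (G : Eu N → Eu N → ℝ) (hμ : μ Ωᶜ = 0) [SFinite (weightedMeasure Ω β μ)] :
    ∀ᵐ x ∂volume.restrict Ω, ∀ᵐ y ∂μ,
      (ENNReal.ofReal (bdist Ω y ^ β)).toReal • normalizedKernel Ω G β x y = G x y := by
  filter_upwards [ae_restrict_mem ho.measurableSet, ae_restrict_of_ae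
    (ae_measure_singleton_eq_zero volume (weightedMeasure Ω β μ))] with x hx hνx
  have hne : ∀ᵐ y ∂weightedMeasure Ω β μ, y ≠ x := by simpa [ae_iff] using hνx
  rw [weightedMeasure, ae_withDensity_iff (measurable_ofReal_bdist_rpow Ω β)] at hne
  have hμΩ : ∀ᵐ y ∂μ, y ∈ Ω := hμ
  filter_upwards [hμΩ, hne] with y hy hyx
  have hδ := bdist_pos ho hb hy
  have hδβ : 0 < bdist Ω y ^ β := Real.rpow_pos_of_pos hδ β
  rw [normalizedKernel_of_mem hx hy (hyx (ENNReal.ofReal_pos.2 hδβ).ne').symm,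
    ENNReal.toReal_ofReal hδβ.le, smul_eq_mul, Real.rpow_neg hδ.le, mul_left_comm,
    mul_inv_cancel₀ hδβ.ne', mul_one]

theorem ae_integral_normalizedKernel [NeZero N] (ho : IsOpen Ω) (hb : Bornology.IsBounded Ω)
    (G : Eu N → Eu N → ℝ) (hμ : μ Ωᶜ = 0) [SFinite (weightedMeasure Ω β μ)] :
    ∀ᵐ x ∂volume.restrict Ω,
      ∫ y, normalizedKernel Ω G β x y ∂weightedMeasure Ω β μ = ∫ y, G x y ∂μ := by
  filter_upwards [ae_smul_normalizedKernel_eq (β := β) ho hb G hμ] with x hx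
  rw [weightedMeasure, integral_withDensity_eq_integral_toReal_smul
    (measurable_ofReal_bdist_rpow Ω β) (by simp)]
  exact integral_congr_ae hx

theorem ae_integrable_normalizedKernel_iff [NeZero N] (ho : IsOpen Ω)
    (hb : Bornology.IsBounded Ω) (G : Eu N → Eu N → ℝ) (hμ : μ Ωᶜ = 0)
    [SFinite (weightedMeasure Ω β μ)] :
    ∀ᵐ x ∂volume.restrict Ω,
      Integrable (normalizedKernel Ω G β x) (weightedMeasure Ω β μ) ↔ Integrable (G x) μ := by
  filter_upwards [ae_smul_normalizedKernel_eq (β := β) ho hb G hμ] with x hx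
  rw [weightedMeasure, integrable_withDensity_iff_integrable_smul'
    (measurable_ofReal_bdist_rpow Ω β) (by simp)]
  exact integrable_congr hx

theorem green_ae_eq [NeZero N] (ho : IsOpen Ω) (hb : Bornology.IsBounded Ω)
    (G : Eu N → Eu N → ℝ) (α : ℝ) (μ : SignedRadonMeasure Ω)
    [SFinite (weightedMeasure Ω β μ.posPart)] [SFinite (weightedMeasure Ω β μ.negPart)] :
    μ.green G =ᵐ[weightedVolume Ω α] fun x ↦
      ∫ y, normalizedKernel Ω G β x y ∂weightedMeasure Ω β μ.posPart -
        ∫ y, normalizedKernel Ω G β x y ∂weightedMeasure Ω β μ.negPart := by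
  rw [EventuallyEq, ae_weightedVolume ho hb]
  filter_upwards [ae_integral_normalizedKernel (β := β) ho hb G μ.posPart_compl,
    ae_integral_normalizedKernel (β := β) ho hb G μ.negPart_compl] with x hpos hneg
  rw [hpos, hneg]
  rfl

theorem isCompactGreenMap_of_isSliceApproximable [NeZero N] (ho : IsOpen Ω)
    (hb : Bornology.IsBounded Ω)
    (hG : Measurable ((offDiagonal Ω).domRestrict (Function.uncurry G))) (hq : 1 ≤ q)
    (h : IsSliceApproximable (normalizedKernel Ω G β) (ENNReal.ofReal q) (weightedVolume Ω α) Ω) :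
    IsCompactGreenMap Ω G β α q := by
  have hK := measurable_normalizedKernel ho hG β
  have hp1 : 1 ≤ ENNReal.ofReal q := ENNReal.one_le_ofReal.2 hq
  have hp : ENNReal.ofReal q ≠ ⊤ := ENNReal.ofReal_ne_top
  have : SFinite (weightedVolume Ω α) := by unfold weightedVolume; infer_instance
  have hpos (μ : SignedRadonMeasure Ω) : weightedMeasure Ω β μ.posPart univ ≤ μ.weightedNorm β :=
    le_self_add.trans_eq (weightedNorm_eq μ β).symm
  have hneg (μ : SignedRadonMeasure Ω) : weightedMeasure Ω β μ.negPart univ ≤ μ.weightedNorm β :=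
    le_add_self.trans_eq (weightedNorm_eq μ β).symm
  refine ⟨fun μ hμ ↦ ?_, fun μ hμ ↦ ?_, fun μ R hR hμ ↦ ?_⟩
  · have : IsFiniteMeasure (weightedMeasure Ω β μ.posPart) := ⟨(hpos μ).trans_lt hμ⟩
    have : IsFiniteMeasure (weightedMeasure Ω β μ.negPart) := ⟨(hneg μ).trans_lt hμ⟩
    have hint₁ := h.ae_integrable hp1 hp hK (ae_mem_weightedMeasure μ.posPart_compl β)
    have hint₂ := h.ae_integrable hp1 hp hK (ae_mem_weightedMeasure μ.negPart_compl β)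
    rw [ae_weightedVolume ho hb] at hint₁ hint₂
    filter_upwards [hint₁, hint₂,
      ae_integrable_normalizedKernel_iff (β := β) ho hb G μ.posPart_compl,
      ae_integrable_normalizedKernel_iff (β := β) ho hb G μ.negPart_compl] with x h₁ h₂ hiff₁ hiff₂
    exact (hiff₁.1 h₁).add_measure (hiff₂.1 h₂)
  · have : IsFiniteMeasure (weightedMeasure Ω β μ.posPart) := ⟨(hpos μ).trans_lt hμ⟩
    have : IsFiniteMeasure (weightedMeasure Ω β μ.negPart) := ⟨(hneg μ).trans_lt hμ⟩
    rw [memLp_congr_ae (green_ae_eq (β := β) ho hb G α μ)]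
    exact (h.memLp_integral hp1 hp hK (ae_mem_weightedMeasure μ.posPart_compl β)).sub
      (h.memLp_integral hp1 hp hK (ae_mem_weightedMeasure μ.negPart_compl β))
  · obtain ⟨k, hk, u, hu, hlim⟩ := h.exists_subseq_tendsto hp1 hp hK hR
      (fun n ↦ ae_mem_weightedMeasure (μ n).posPart_compl β)
      (fun n ↦ ae_mem_weightedMeasure (μ n).negPart_compl β)
      (fun n ↦ (hpos (μ n)).trans (hμ n)) fun n ↦ (hneg (μ n)).trans (hμ n)
    refine ⟨k, hk, u, hu, hlim.congr fun n ↦ eLpNorm_congr_ae ?_⟩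
    have hfin := (hμ (k n)).trans_lt hR
    have : IsFiniteMeasure (weightedMeasure Ω β (μ (k n)).posPart) := ⟨(hpos _).trans_lt hfin⟩
    have : IsFiniteMeasure (weightedMeasure Ω β (μ (k n)).negPart) := ⟨(hneg _).trans_lt hfin⟩
    filter_upwards [green_ae_eq (β := β) ho hb G α (μ (k n))] with x hx
    rw [hx]

end GreenMap

section Limits

variable {G : Eu N → Eu N → ℝ} {s γ β α q : ℝ} {x z : Eu N}

theorem normalizedKernel_eventuallyEq (G : Eu N → Eu N → ℝ) (β : ℝ) (hx : x ∈ Ω) (hxz : x ≠ z) :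
    normalizedKernel Ω G β x =ᶠ[𝓝[Ω] z] fun y ↦ G x y * bdist Ω y ^ (-β) := by
  filter_upwards [self_mem_nhdsWithin, mem_nhdsWithin_of_mem_nhds (isOpen_ne.mem_nhds hxz.symm)]
    with y hy hyx using normalizedKernel_of_mem hx hy (Ne.symm hyx)

theorem tendsto_normalizedKernel_of_mem [NeZero N] (ho : IsOpen Ω) (hb : Bornology.IsBounded Ω)
    (hG : ContinuousOn (G x) (Ω \ {x})) (hx : x ∈ Ω) (hz : z ∈ Ω) (hxz : x ≠ z) :
    Tendsto (normalizedKernel Ω G β x) (𝓝[Ω] z) (𝓝 (G x z * bdist Ω z ^ (-β))) := by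
  have hGz : ContinuousAt (G x) z :=
    hG.continuousAt ((ho.sdiff isClosed_singleton).mem_nhds ⟨hz, hxz.symm⟩)
  have hδz : ContinuousAt (fun y ↦ bdist Ω y ^ (-β)) z :=
    (continuous_bdist Ω).continuousAt.rpow_const (Or.inl (bdist_pos ho hb hz).ne')
  exact ((hGz.mul hδz).tendsto.mono_left nhdsWithin_le_nhds).congr'
    (normalizedKernel_eventuallyEq G β hx hxz).symm

theorem tendsto_normalizedKernel_of_tendsto_div {l : ℝ} (hx : x ∈ Ω) (hxz : x ≠ z)
    (h : Tendsto (fun y ↦ G x y / bdist Ω y ^ γ) (𝓝[Ω] z) (𝓝 l)) :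
    Tendsto (normalizedKernel Ω G γ x) (𝓝[Ω] z) (𝓝 l) := by
  refine Tendsto.congr' (normalizedKernel_eventuallyEq G γ hx hxz).symm (h.congr fun y ↦ ?_)
  rw [Real.rpow_neg (bdist_nonneg Ω y), div_eq_mul_inv]

theorem abs_normalizedKernel_le [NeZero N] (ho : IsOpen Ω) (hb : Bornology.IsBounded Ω)
    {C : ℝ≥0} (hC : ∀ x ∈ Ω, ∀ y ∈ Ω, x ≠ y → |G x y| ≤ C * greenProfile Ω s γ x y)
    {x y : Eu N} (hx : x ∈ Ω) (hy : y ∈ Ω) (hxy : x ≠ y) {θ : ℝ} (hβ : 0 ≤ β) (hβγ : β ≤ γ)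
    (hγθ : -γ ≤ θ) (hθβ : θ ≤ β) :
    |normalizedKernel Ω G β x y| ≤
      C * 2 ^ γ * (‖x - y‖ ^ (-(N - 2 * s + β - θ)) * bdist Ω x ^ (-θ)) := by
  have hδy : 0 ≤ bdist Ω y ^ (-β) := Real.rpow_nonneg (bdist_nonneg Ω y) _
  calc |normalizedKernel Ω G β x y| = |G x y| * bdist Ω y ^ (-β) := by
        rw [normalizedKernel_of_mem hx hy hxy, abs_mul, abs_of_nonneg hδy]
    _ ≤ C * greenProfile Ω s γ x y * bdist Ω y ^ (-β) := by
        gcongr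
        exact hC x hx y hy hxy
    _ ≤ C * 2 ^ γ * (‖x - y‖ ^ (-(N - 2 * s + β - θ)) * bdist Ω x ^ (-θ)) := by
        rw [mul_assoc, mul_assoc]
        exact mul_le_mul_of_nonneg_left (greenProfile_mul_bdist_rpow_le hxy (bdist_pos ho hb hx)
          (bdist_pos ho hb hy) hβ hβγ hγθ hθβ) C.coe_nonneg

theorem tendsto_normalizedKernel_zero [NeZero N] (ho : IsOpen Ω) (hb : Bornology.IsBounded Ω)
    {C : ℝ≥0} (hC : ∀ x ∈ Ω, ∀ y ∈ Ω, x ≠ y → |G x y| ≤ C * greenProfile Ω s γ x y)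
    (hβ : 0 ≤ β) (hβγ : β < γ) (hx : x ∈ Ω) (hz : z ∉ Ω) :
    Tendsto (normalizedKernel Ω G β x) (𝓝[Ω] z) (𝓝 0) := by
  have hγ : 0 ≤ γ := hβ.trans hβγ.le
  have hxz : x ≠ z := fun h ↦ hz (h ▸ hx)
  have hδ : ContinuousAt (fun y ↦ bdist Ω y ^ (γ - β)) z :=
    (continuous_bdist Ω).continuousAt.rpow_const (Or.inr (sub_nonneg.2 hβγ.le))
  have hr : ContinuousAt (fun y ↦ ‖x - y‖ ^ (-(N - 2 * s + γ))) z :=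
    (by fun_prop : ContinuousAt (fun y ↦ ‖x - y‖) z).rpow_const
      (Or.inl (norm_ne_zero_iff.2 (sub_ne_zero.2 hxz)))
  have hδz : bdist Ω z ^ (γ - β) = 0 := by
    rw [bdist, infDist_zero_of_mem hz, Real.zero_rpow (sub_pos.2 hβγ).ne']
  have hlim : Tendsto (fun y ↦ C * 2 ^ γ * ‖x - y‖ ^ (-(N - 2 * s + γ)) * bdist Ω y ^ (γ - β))
      (𝓝[Ω] z) (𝓝 0) := by
    have h := (hr.tendsto.const_mul ((C : ℝ) * 2 ^ γ)).mul hδ.tendsto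
    rw [hδz, mul_zero] at h
    exact h.mono_left nhdsWithin_le_nhds
  refine squeeze_zero_norm' ?_ hlim
  filter_upwards [self_mem_nhdsWithin, mem_nhdsWithin_of_mem_nhds (isOpen_ne.mem_nhds hxz.symm)]
    with y hy hyx
  have hxy : x ≠ y := Ne.symm hyx
  have hδy := bdist_pos ho hb hy
  have hKγ : |normalizedKernel Ω G γ x y| ≤ C * 2 ^ γ * ‖x - y‖ ^ (-(N - 2 * s + γ)) := by
    simpa only [sub_zero, neg_zero, Real.rpow_zero, mul_one] using
      abs_normalizedKernel_le ho hb hC hx hy hxy hγ le_rfl (neg_nonpos.2 hγ) hγ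
  have hKβ : normalizedKernel Ω G β x y = normalizedKernel Ω G γ x y * bdist Ω y ^ (γ - β) := by
    rw [normalizedKernel_of_mem hx hy hxy, normalizedKernel_of_mem hx hy hxy, mul_assoc,
      ← Real.rpow_add hδy, neg_add_eq_sub, sub_sub_cancel_left]
  rw [hKβ, norm_mul, Real.norm_eq_abs, Real.norm_of_nonneg (Real.rpow_nonneg hδy.le _)]
  gcongr

theorem exists_bdist_le (hb : Bornology.IsBounded Ω) : ∃ D, ∀ x ∈ Ω, bdist Ω x ≤ D := by
  obtain ⟨D, hD⟩ := hb.isCompact_closure.exists_bound_of_continuousOn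
    (continuous_bdist Ω).continuousOn
  exact ⟨D, fun x hx ↦ (le_abs_self _).trans (hD x (subset_closure hx))⟩

theorem exists_hasSingularBound_normalizedKernel [NeZero N] (ho : IsOpen Ω)
    (hb : Bornology.IsBounded Ω) {C : ℝ≥0}
    (hC : ∀ x ∈ Ω, ∀ y ∈ Ω, x ≠ y → |G x y| ≤ C * greenProfile Ω s γ x y) (hβ : 0 ≤ β)
    (hβγ : β ≤ γ) {θ a : ℝ} (hγθ : -γ ≤ θ) (hθβ : θ ≤ β) (hq : 0 ≤ q) (hθa : q * θ ≤ α + a) :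
    ∃ B : ℝ≥0, ∀ y ∈ Ω, HasSingularBound Ω α q a (q * (N - 2 * s + β - θ)) B y
      (normalizedKernel Ω G β · y) := by
  obtain ⟨D, hD⟩ := exists_bdist_le hb
  refine ⟨((C : ℝ) * 2 ^ γ).toNNReal ^ q * (D ^ (α + a - q * θ)).toNNReal, fun y hy ↦ ?_⟩
  filter_upwards [ae_restrict_mem ho.measurableSet, ae_restrict_of_ae (Measure.ae_ne volume y)]
    with x hx hxy
  have hδ := bdist_pos ho hb hx
  have hA : 0 ≤ (C : ℝ) * 2 ^ γ := by positivity
  have hr : 0 ≤ ‖x - y‖ := norm_nonneg _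
  rw [NNReal.coe_mul, NNReal.coe_rpow, Real.coe_toNNReal _ hA,
    Real.coe_toNNReal _ (Real.rpow_nonneg (hδ.le.trans (hD x hx)) _), dist_eq_norm]
  calc |normalizedKernel Ω G β x y| ^ q * bdist Ω x ^ (α + a)
      ≤ (C * 2 ^ γ * (‖x - y‖ ^ (-(N - 2 * s + β - θ)) * bdist Ω x ^ (-θ))) ^ q *
          bdist Ω x ^ (α + a) := by
        gcongr
        exact abs_normalizedKernel_le ho hb hC hx hy hxy hβ hβγ hγθ hθβ
    _ = (C * 2 ^ γ) ^ q * bdist Ω x ^ (α + a - q * θ) *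
          ‖x - y‖ ^ (-(q * (N - 2 * s + β - θ))) := by
        have hδθ : 0 ≤ bdist Ω x ^ (-θ) := Real.rpow_nonneg hδ.le _
        rw [Real.mul_rpow hA (by positivity), Real.mul_rpow (Real.rpow_nonneg hr _) hδθ,
          ← Real.rpow_mul hr, ← Real.rpow_mul hδ.le,
          sub_eq_neg_add (α + a), Real.rpow_add hδ (-(q * θ)), neg_mul, neg_mul, mul_comm q θ,
          mul_comm q]
        ring
    _ ≤ _ := by
        gcongr
        exact hD x hx

theorem tendsto_normalizedKernel [NeZero N] (ho : IsOpen Ω) (hb : Bornology.IsBounded Ω)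
    {C : ℝ≥0} (hC : ∀ x ∈ Ω, ∀ y ∈ Ω, x ≠ y → |G x y| ≤ C * greenProfile Ω s γ x y)
    (hG : ∀ x ∈ Ω, ContinuousOn (G x) (Ω \ {x})) (hβ : 0 ≤ β) (hβγ : β ≤ γ)
    (hlim : β = γ → ∀ x ∈ Ω, ∀ z ∈ frontier Ω,
      ∃ l, Tendsto (fun y ↦ G x y / bdist Ω y ^ γ) (𝓝[Ω] z) (𝓝 l))
    (hz : z ∈ closure Ω) (hx : x ∈ Ω) (hxz : x ≠ z) :
    ∃ l, Tendsto (normalizedKernel Ω G β x) (𝓝[Ω] z) (𝓝 l) := by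
  by_cases hzΩ : z ∈ Ω
  · exact ⟨_, tendsto_normalizedKernel_of_mem ho hb (hG x hx) hx hzΩ hxz⟩
  obtain hβγ | rfl := hβγ.lt_or_eq
  · exact ⟨0, tendsto_normalizedKernel_zero ho hb hC hβ hβγ hx hzΩ⟩
  · obtain ⟨l, hl⟩ := hlim rfl x hx z (ho.frontier_eq ▸ ⟨hz, hzΩ⟩)
    exact ⟨l, tendsto_normalizedKernel_of_tendsto_div hx hxz hl⟩

end Limits

section GreenFunction

variable {G : Eu N → Eu N → ℝ} {s γ β α q : ℝ}

theorem IsGreenFunction.exists_abs_le {GG : (Eu N → ℝ) → Eu N → ℝ}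
    (h : IsGreenFunction Ω s γ GG G) :
    ∃ C : ℝ≥0, ∀ x ∈ Ω, ∀ y ∈ Ω, x ≠ y → |G x y| ≤ C * greenProfile Ω s γ x y := by
  obtain ⟨c, C, -, hC, hG⟩ := h.estimate
  refine ⟨⟨C, hC.le⟩, fun x hx y hy hxy ↦ ?_⟩
  rw [abs_of_pos (h.pos x hx y hy hxy)]
  exact (hG x hx y hy hxy).2

theorem continuousOn_slice_of_offDiagonal
    (h : ContinuousOn (Function.uncurry G) (offDiagonal Ω)) {x : Eu N} (hx : x ∈ Ω) :
    ContinuousOn (G x) (Ω \ {x}) :=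
  h.comp (Continuous.prodMk_right x).continuousOn fun _ hy ↦ ⟨hx, hy.1, Ne.symm hy.2⟩

theorem HasMartinLimit.exists_tendsto (h : HasMartinLimit Ω γ G) {x z : Eu N} (hx : x ∈ Ω)
    (hz : z ∈ frontier Ω) : ∃ l, Tendsto (fun y ↦ G x y / bdist Ω y ^ γ) (𝓝[Ω] z) (𝓝 l) := by
  obtain ⟨M, hM, -⟩ := h
  have hy : Tendsto (fun y ↦ (x, y)) (𝓝[Ω] z) (𝓝[Ω ×ˢ Ω] (x, z)) := by
    rw [nhdsWithin_prod_eq]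
    exact (tendsto_const_pure.mono_right (pure_le_nhdsWithin hx)).prodMk tendsto_id
  exact ⟨M x z, (hM x hx z hz).2.comp hy⟩

theorem Admissible.neg_sub_one_lt (h : Admissible N s β α) : -β - 1 < α :=
  ((le_max_left _ _).trans (le_max_left _ _)).trans_lt h.1

theorem mul_lt_add_of_lt_critExp (hN : 2 * s < N) (hβ : 0 ≤ β) (hq : q < critExp N s β α) :
    q * (N - 2 * s + β) < N + α := by
  rw [critExp, lt_div_iff₀ (by linarith)] at hq
  linarith

theorem Admissible.mul_lt_of_lt_critExp (h : Admissible N s β α) (hN : 2 * s < N) (hβ : 0 ≤ β)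
    (hq : q < critExp N s β α) : q * (N - 2 * s) < N := by
  have hα := (lt_div_iff₀ (sub_pos.2 hN)).1 h.2
  have hqα := mul_lt_add_of_lt_critExp hN hβ hq
  have hNβ : 0 < N - 2 * s + β := by linarith
  have : 0 < N - 2 * s := sub_pos.2 hN
  refine lt_of_mul_lt_mul_right ?_ hNβ.le
  calc q * (N - 2 * s) * (N - 2 * s + β) = q * (N - 2 * s + β) * (N - 2 * s) := by ring
    _ < (N + α) * (N - 2 * s) := by gcongr
    _ ≤ N * (N - 2 * s + β) := by linarith

end GreenFunction

end GreenCompactness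

open GreenCompactness in
theorem theorem3p1_general {N : ℕ} {s β γ α q : ℝ} {Ω : Set (Eu N)} {G : Eu N → Eu N → ℝ}
    (hΩ : IsThinCollarDomain Ω) (hN : 2 * s < N)
    (hmeas : Measurable ((offDiagonal Ω).domRestrict (Function.uncurry G)))
    (hbound : ∃ C : NNReal, ∀ x ∈ Ω, ∀ y ∈ Ω, x ≠ y → |G x y| ≤ C * greenProfile Ω s γ x y)
    (hcont : ∀ x ∈ Ω, ContinuousOn (G x) (Ω \ {x})) (hβ : 0 ≤ β) (hβγ : β ≤ γ)
    (hlim : β = γ → ∀ x ∈ Ω, ∀ z ∈ frontier Ω,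
      ∃ l, Tendsto (fun y ↦ G x y / bdist Ω y ^ γ) (𝓝[Ω] z) (𝓝 l))
    (hα : -β - 1 < α) (hq : 1 ≤ q) (hqN : q * (N - 2 * s) < N)
    (hqα : q * (N - 2 * s + β) < N + α) :
    IsCompactGreenMap Ω G β α q := by
  have : NeZero N := ⟨by rintro rfl; norm_num at hN hqN; nlinarith⟩
  obtain ⟨C, hC⟩ := hbound
  obtain ⟨θ, a, hγθ, hθβ, ha, ha1, hθa, hab⟩ := exists_singularity_exponents hβ hβγ hα hq hqN hqα
  have hb : 0 ≤ q * (N - 2 * s + β - θ) := mul_nonneg (by linarith) (by linarith)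
  obtain ⟨B, hB⟩ := exists_hasSingularBound_normalizedKernel hΩ.isOpen hΩ.isBounded hC hβ hβγ
    hγθ hθβ (zero_le_one.trans hq) hθa
  exact isCompactGreenMap_of_isSliceApproximable hΩ.isOpen hΩ.isBounded hmeas hq <|
    isSliceApproximable_of_hasSingularBound hΩ hq ha ha1 hb hab
      (measurable_normalizedKernel hΩ.isOpen hmeas β) hB fun z hz x hx hxz ↦
      tendsto_normalizedKernel hΩ.isOpen hΩ.isBounded hC hcont hβ hβγ hlim hz hx hxz

open GreenCompactness in
theorem GreenCompactness.IsGreenFunction.isCompactGreenMap {N : ℕ} {s β γ α q : ℝ}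
    {Ω : Set (Eu N)} {GG : (Eu N → ℝ) → Eu N → ℝ} {G : Eu N → Eu N → ℝ}
    (hG : IsGreenFunction Ω s γ GG G) (hs : 0 < s) (hN : 2 * s < N) (hΩ : IsC2BoundedDomain Ω)
    (hcont : ContinuousOn (Function.uncurry G) (offDiagonal Ω)) (hβ : 0 ≤ β) (hβγ : β ≤ γ)
    (hM : β = γ → HasMartinLimit Ω γ G) (hα : Admissible N s β α) (hq : 1 ≤ q)
    (hqp : q < critExp N s β α) : IsCompactGreenMap Ω G β α q :=
  have : NeZero N := ⟨by rintro rfl; norm_num at hN; linarith⟩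
  theorem3p1_general hΩ.isThinCollarDomain hN hG.measurable hG.exists_abs_le
    (fun _ ↦ continuousOn_slice_of_offDiagonal hcont) hβ hβγ
    (fun h _ hx _ ↦ (hM h).exists_tendsto hx) hα.neg_sub_one_lt hq
    (hα.mul_lt_of_lt_critExp hN hβ hqp) (mul_lt_add_of_lt_critExp hN hβ hqp)

theorem theorem3p1 {N : ℕ} {s γ : ℝ} (hs : 0 < s) (hs1 : s ≤ 1) (hγ : 0 < γ) (hγ1 : γ ≤ 1)
    (hN : 2 * s < (N : ℝ))
    (Ω : Set (GreenCompactness.Eu N)) (hΩ : GreenCompactness.IsC2BoundedDomain Ω)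
    (L : GreenCompactness.L2 Ω →ₗ.[ℝ] GreenCompactness.L2 Ω)
    (GG : (GreenCompactness.Eu N → ℝ) → GreenCompactness.Eu N → ℝ)
    (G : GreenCompactness.Eu N → GreenCompactness.Eu N → ℝ)
    (hG1 : GreenCompactness.IsGreenOperator Ω L GG)
    (hG2 : GreenCompactness.IsGreenFunction Ω s γ GG G)
    (hG3 : ContinuousOn (Function.uncurry G) (GreenCompactness.offDiagonal Ω)) :
    (∀ γ' : ℝ, 0 ≤ γ' → γ' < γ → ∀ α : ℝ, GreenCompactness.Admissible N s γ' α →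
      ∀ q : ℝ, 1 ≤ q → q < GreenCompactness.critExp N s γ' α →
        GreenCompactness.IsCompactGreenMap Ω G γ' α q) ∧
    (GreenCompactness.HasMartinLimit Ω γ G →
      ∀ α : ℝ, GreenCompactness.Admissible N s γ α →
      ∀ q : ℝ, 1 ≤ q → q < GreenCompactness.critExp N s γ α →
        GreenCompactness.IsCompactGreenMap Ω G γ α q) := by
  exact ⟨fun _ hβ hβγ _ hα _ hq hqp ↦
      hG2.isCompactGreenMap hs hN hΩ hG3 hβ hβγ.le (absurd · hβγ.ne) hα hq hqp,
    fun hM _ hα _ hq hqp ↦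
      hG2.isCompactGreenMap hs hN hΩ hG3 hγ.le le_rfl (fun _ ↦ hM) hα hq hqp⟩
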